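/- **Setting.** Let $e_t$, $t\in\mathbb Z$, be independent random elements of a measurable space. For every sample size $T=1,2,\dots$ let $d=d_T$ and $p=p_T$ be integers, let $\mathbf A^{(1)},\dots,\mathbf A^{(p)}\in\mathbb R^{d\times d}$ (which may depend on $T$), and let $\mathbf x^{(t)},\boldsymbol\epsilon^{(t)}$, $t\in\mathbb Z$, be random vectors in $\mathbb R^d$ (whose laws may depend on $T$). Constants below, and bounds written $O(\cdot)$, do not depend on $T$. Put $\mathbf z^{(t)}=(\mathbf x^{(t)\top},\mathbf x^{(t-1)\top},\dots,\mathbf x^{(t-p+1)\top})^\top\in\mathbb R^{pd}$; let $\mathbf W$ be the $(T-p)\times pd$ matrix with rows $\mathbf z^{(p)\top},\dots,\mathbf z^{(T-1)\top}$, let $\mathbf S=[\mathbf A^{(1)},\dots,\mathbf A^{(p)}]^\top\in\mathbb R^{pd\times d}$ with columns $\mathbf S_{\cdot l}$, and, for $l=1,\dots,d$, put $\mathbf y^{(l)}=(\mathbf x^{(p+1)}_l,\dots,\mathbf x^{(T)}_l)^\top$, $\boldsymbol\eta^{(l)}=(\boldsymbol\epsilon^{(p+1)}_l,\dots,\boldsymbol\epsilon^{(T)}_l)^\top$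 (when $T\le p$ these and $\mathbf W$ have no rows) and $\mathcal B_l=\{j:\mathbf S_{jl}\ne0\}$. The vectors $\mathbf x^{(t)}$ are called $(m,\alpha)$-short range dependent if $\mathbf x^{(t)}_i=g^{(t,T)}_i(\dots,e_{t-1},e_t)$ almost surely with measurable functions $g_i^{(t,T)}$, $\mathbf E\mathbf x^{(t)}=0$, $\sup_{t,i}\Vert\mathbf x^{(t)}_i\Vert_m=O(1)$ and $\sup_{k\ge0}(1+k)^\alpha\sum_{j\ge k}\delta^{(j)}=O(1)$. Here $\Vert X\Vert_m=(\mathbf E|X|^m)^{1/m}$ and $\delta^{(j)}=\sup_{t,i}\Vert\mathbf x_i^{(t)}-\mathbf x_i^{(t,j)}\Vert_m$, where $\mathbf x_i^{(t,j)}$ is obtained from $g_i^{(t,T)}(\dots,e_{t-1},e_t)$ by replacing $e_{t-j}$ with an independent copy $e_{t-j}^\dagger$. **Assumption 1.** $\mathbf x^{(t)}=\sum_{j=1}^p\mathbf A^{(j)}\mathbf x^{(t-j)}+\boldsymbol\epsilon^{(t)}$ almost surely for every $t\in\mathbb Z$. The innovations are white noise: they are square integrable, $\mathbf E\boldsymbol\epsilon^{(t)}=0$,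 and $\mathbf E\boldsymbol\epsilon^{(t_1)}\boldsymbol\epsilon^{(t_2)\top}$ equals $0$ if $t_1\neq t_2$ and a matrix not depending on $t_1$ if $t_1=t_2$. The $\mathbf x^{(t)}$ are $(m,\alpha)$-short range dependent with constants $m>8$, $\alpha>1$. Moreover $p=O(1)$ and $d=O(T^{\alpha_d})$ with a constant $0\le\alpha_d<\frac{m\alpha}{2+24\alpha}$. **Assumption 2.** $\lambda=c_\lambda T^{-\alpha_\lambda}$ with constants $c_\lambda>0$ and $0<\alpha_\lambda<\frac12-\frac{4\alpha_d}{m}$. The threshold satisfies $b_T\to0$ and $b_T/\lambda\to\infty$. Further, $\max_l|\mathcal B_l|=O(1)$, $\max_l|\mathcal B_l|>0$, and $|\mathbf S_{jl}|>2b_T$ for all $l$ and $j\in\mathcal B_l$. All complex eigenvalues of the $pd\times pd$ matrix $$\mathbf S^\dagger=\begin{bmatrix}&\mathbf S^\top&&\\ \mathbf I_d&&0&0\\&\ddots&&\vdots\\0&&\mathbf I_d&0\end{bmatrix}^\top$$ are less than $1$ in absolute value, and the minimum eigenvalue of $\boldsymbol\Sigma^{(0)}=\mathbf E\mathbf z^{(p)}\mathbf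 z^{(p)\top}$ is greater than a constant $c_\Sigma>0$. **Assumption 3.** For a $pd\times pd$ matrix $\mathbf M$ and a set $\mathcal B$ of indices let $\mathcal F_{\mathcal B}(\mathbf M)$ be the $pd\times pd$ matrix whose $\mathcal B\times\mathcal B$ block is the Moore–Penrose inverse of the $\mathcal B\times\mathcal B$ submatrix of $\mathbf M$ and whose other entries are $0$. With $$\boldsymbol\Lambda^{(l,l)}=\mathcal F_{\mathcal B_l}(\boldsymbol\Sigma^{(0)})\Big(\tfrac1T\mathbf E\,\mathbf W^\top\boldsymbol\eta^{(l)}\boldsymbol\eta^{(l)\top}\mathbf W\Big)\mathcal F_{\mathcal B_l}(\boldsymbol\Sigma^{(0)}),$$ there is a constant $c_\Lambda>0$ such that, for all sufficiently large $T$, $\boldsymbol\Lambda^{(l,l)}_{jj}>c_\Lambda$ for all $l$ and $j\in\mathcal B_l$. **Theorem.** Let Assumptions 1–3 hold, and let $\widetilde{\mathbf S}\in\mathbb R^{pd\times d}$ be a Lasso estimator, that is, for every $l=1,\dots,d$, $$\widetilde{\mathbf S}_{\cdot l}\in\operatorname*{arg\,min}_{\mathbf s\in\mathbb R^{pd}}\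 \frac1{2T}|\mathbf y^{(l)}-\mathbf W\mathbf s|_2^2+\lambda|\mathbf s|_1 .$$ Then $$\max_{l=1,\dots,d}|\widetilde{\mathbf S}_{\cdot l}-\mathbf S_{\cdot l}|_1=O_p(\lambda)\quad\text{and}\quad\max_{l=1,\dots,d}|\widetilde{\mathbf S}_{\cdot l}-\mathbf S_{\cdot l}|_2=O_p(\lambda),$$ where $X_T=O_p(Y_T)$ means that for every $0<\varepsilon<1$ there is $C_\varepsilon>0$ with $\operatorname{Prob}(|X_T|\le C_\varepsilon|Y_T|)\ge1-\varepsilon$ for all $T\ge1$. Moreover, with $\widetilde{\mathcal B}_l=\{j:|\widetilde{\mathbf S}_{jl}|>b_T\}$, $$\operatorname{Prob}\Big(\bigcup_{l=1}^d\{\widetilde{\mathcal B}_l\ne\mathcal B_l\}\Big)\to0\qquad(T\to\infty).$$ -/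

import Mathlib

open MeasureTheory ProbabilityTheory Filter Topology
open scoped ENNReal Matrix

namespace LassoVAR

noncomputable section

/-! ### Stochastic order and vector norms -/

/-- `X n = O_p(Y n)`, for sequences indexed by `n = 1, 2, …`: for every `0 < ε < 1` there is `C > 0`
such that, for every `n ≥ 1`, the event `|X n| ≤ C |Y n|` fails with probability at most `ε`. -/
def IsBigOp {Ω : Type*} [MeasurableSpace Ω] (P : Measure Ω) (X Y : ℕ → Ω → ℝ) : Prop :=
  ∀ ε : ℝ, 0 < ε → ε < 1 → ∃ C : ℝ, 0 < C ∧ ∀ n : ℕ, 1 ≤ n →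
    P {ω | ¬ |X n ω| ≤ C * |Y n ω|} ≤ ENNReal.ofReal ε

/-- The `ℓ¹` norm of a vector. -/
def l1norm {ι : Type*} [Fintype ι] (v : ι → ℝ) : ℝ := ∑ i, |v i|

/-- The `ℓ²` norm of a vector. -/
def l2norm {ι : Type*} [Fintype ι] (v : ι → ℝ) : ℝ := √(∑ i, v i ^ 2)

/-! ### Moore–Penrose inverse and the partial inverse operator -/

/-- The four Penrose equations for a real square matrix. -/
structure IsMoorePenrose {n : Type*} [Fintype n] (A Z : Matrix n n ℝ) : Prop where
  mul_mul_self : A * Z * A = A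
  self_mul_mul : Z * A * Z = Z
  symm_left : (A * Z)ᵀ = A * Z
  symm_right : (Z * A)ᵀ = Z * A

theorem exists_isMoorePenrose {n : Type*} [Fintype n] [DecidableEq n] (A : Matrix n n ℝ) :
    ∃ Z : Matrix n n ℝ, IsMoorePenrose A Z := by
  set H : Matrix n n ℝ := Aᵀ * A with hH
  have hHT : Hᵀ = H := by simp [hH]
  have hHh : H.IsHermitian := by
    rw [Matrix.IsHermitian, Matrix.conjTranspose_eq_transpose_of_trivial, hHT]
  obtain ⟨K, hKT, hKHK, hHKH, hcomm⟩ : ∃ K : Matrix n n ℝ,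
      Kᵀ = K ∧ K * H * K = K ∧ H * K * H = H ∧ K * H = H * K := by
    let U : Matrix n n ℝ := hHh.eigenvectorUnitary
    have hUU : Uᵀ * U = 1 := by
      have := Unitary.coe_star_mul_self hHh.eigenvectorUnitary
      rwa [Matrix.star_eq_conjTranspose, Matrix.conjTranspose_eq_transpose_of_trivial] at this
    have key : ∀ D D' : n → ℝ, (U * Matrix.diagonal D * Uᵀ) * (U * Matrix.diagonal D' * Uᵀ)
        = U * Matrix.diagonal (fun i => D i * D' i) * Uᵀ := by
      intro D D'
      rw [← Matrix.diagonal_mul_diagonal]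
      calc _ = U * Matrix.diagonal D * (Uᵀ * U) * Matrix.diagonal D' * Uᵀ := by
            simp only [Matrix.mul_assoc]
        _ = _ := by rw [hUU]; simp only [Matrix.mul_assoc, Matrix.mul_one]
    have hspec : H = U * Matrix.diagonal hHh.eigenvalues * Uᵀ := by
      have := hHh.spectral_theorem
      simpa [Unitary.conjStarAlgAut_apply, Matrix.star_eq_conjTranspose,
        Matrix.conjTranspose_eq_transpose_of_trivial] using this
    clear_value U
    generalize hHh.eigenvalues = D at hspec
    clear_value H
    subst hspec
    refine ⟨U * Matrix.diagonal (fun i => (D i)⁻¹) * Uᵀ, ?_, ?_, ?_, ?_⟩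
    · simp [Matrix.transpose_mul, Matrix.mul_assoc]
    · rw [key, key]
      congr 3; ext i
      by_cases h : D i = 0 <;> simp [h]
    · rw [key, key]
      congr 3; ext i
      by_cases h : D i = 0 <;> simp [h]
    · rw [key, key]
      congr 3; ext i
      rw [mul_comm]
  refine ⟨K * Aᵀ, ?_, ?_, ?_, ?_⟩
  · have h : (A * K * H - A)ᵀ * (A * K * H - A) = 0 := by
      simp only [Matrix.transpose_sub, Matrix.transpose_mul, hKT, hHT, Matrix.sub_mul,
        Matrix.mul_sub]
      have e1 : H * (K * Aᵀ) * (A * K * H) = H := by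
        rw [show H * (K * Aᵀ) * (A * K * H) = H * K * (Aᵀ * A) * K * H by
          simp only [Matrix.mul_assoc], ← hH, hHKH, hHKH]
      have e2 : H * (K * Aᵀ) * A = H := by
        rw [show H * (K * Aᵀ) * A = H * K * (Aᵀ * A) by simp only [Matrix.mul_assoc], ← hH, hHKH]
      have e3 : Aᵀ * (A * K * H) = H := by
        rw [show Aᵀ * (A * K * H) = (Aᵀ * A) * K * H by simp only [Matrix.mul_assoc], ← hH, hHKH]
      rw [e1, e2, e3, ← hH]; simp
    rw [← Matrix.conjTranspose_eq_transpose_of_trivial,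
      Matrix.conjTranspose_mul_self_eq_zero, sub_eq_zero] at h
    simpa [hH, Matrix.mul_assoc] using h
  · rw [show K * Aᵀ * A * (K * Aᵀ) = (K * (Aᵀ * A) * K) * Aᵀ by simp only [Matrix.mul_assoc],
      ← hH, hKHK]
  · simp [Matrix.transpose_mul, hKT, Matrix.mul_assoc]
  · rw [show K * Aᵀ * A = K * H by simp only [hH, Matrix.mul_assoc], Matrix.transpose_mul, hKT,
      hHT, hcomm]

/-- The Moore–Penrose pseudo-inverse of a real square matrix. -/
def pseudoInverse {n : Type*} [Fintype n] [DecidableEq n] (A : Matrix n n ℝ) : Matrix n n ℝ :=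
  (exists_isMoorePenrose A).choose

/-- The partial inverse `𝓕_B(A)`: the pseudo-inverse of the submatrix `A_B`, padded with zeros. -/
def partialInverse {n : Type*} [DecidableEq n] (B : Finset n) (A : Matrix n n ℝ) :
    Matrix n n ℝ :=
  Matrix.of fun i j =>
    if h : i ∈ B ∧ j ∈ B then
      pseudoInverse (A.submatrix (fun b : B => (b : n)) (fun b : B => (b : n)))
        ⟨i, h.1⟩ ⟨j, h.2⟩
    else 0

/-! ### White noise and short range dependence -/

/-- White noise: centred, square integrable, uncorrelated over time, with a covariance matrix that
does not depend on time. -/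
structure IsWhiteNoise {Ω : Type*} [MeasurableSpace Ω] (P : Measure Ω) {d : ℕ}
    (eps : ℤ → Ω → Fin d → ℝ) : Prop where
  memLp : ∀ t i, MemLp (fun ω => eps t ω i) 2 P
  mean_zero : ∀ t i, ∫ ω, eps t ω i ∂P = 0
  cov : ∃ Sig : Matrix (Fin d) (Fin d) ℝ, ∀ t₁ t₂ i j,
    ∫ ω, eps t₁ ω i * eps t₂ ω j ∂P = if t₁ = t₂ then Sig i j else 0

/-- The dependence coefficient `δ^{(j)} = sup_{t, i} ‖g_i(…, e_{t-1}, e_t) - g_i(…, e†_{t-j}, …, e_t)‖_m`.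
The argument `k ↦ e_{t-k}` lists the past of time `t`. The two sequences are realised on
`(Ω × Ω, P ⊗ P)` as `e_s(ω, ω') = e_s(ω)` and the independent copy `e†_s(ω, ω') = e_s(ω')`. -/
def dependenceCoeff {Ω E : Type*} [MeasurableSpace Ω] (P : Measure Ω) (e : ℤ → Ω → E)
    (m : ℝ) {d : ℕ} (g : ℤ → Fin d → (ℕ → E) → ℝ) (j : ℕ) : ℝ≥0∞ :=
  ⨆ (t : ℤ) (i : Fin d), eLpNorm (fun w : Ω × Ω =>
    g t i (fun k => e (t - k) w.1)
      - g t i (Function.update (fun k : ℕ => e (t - k) w.1) j (e (t - j) w.2)))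
    (ENNReal.ofReal m) (P.prod P)

/-- `(m, α)`-short range dependence of an array `x T t`, `T ≥ 1`, `t ∈ ℤ`, of random vectors of
dimension `d T` that are driven by the independent variables `e t`. The bounds are uniform in the
sample size `T`. -/
def IsShortRangeDependent {Ω E : Type*} [MeasurableSpace Ω] [MeasurableSpace E] (P : Measure Ω)
    (e : ℤ → Ω → E) (m α : ℝ) (d : ℕ → ℕ) (x : (T : ℕ) → ℤ → Ω → Fin (d T) → ℝ) : Prop :=
  ∃ g : (T : ℕ) → ℤ → Fin (d T) → (ℕ → E) → ℝ,
    (∀ T t i, Measurable (g T t i)) ∧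
    (∀ T, 1 ≤ T → ∀ t i, ∀ᵐ ω ∂P, x T t ω i = g T t i (fun k => e (t - k) ω)) ∧
    (∀ T, 1 ≤ T → ∀ t i, ∫ ω, x T t ω i ∂P = 0) ∧
    (∃ C : ℝ, ∀ T, 1 ≤ T → ∀ t i,
      eLpNorm (fun ω => x T t ω i) (ENNReal.ofReal m) P ≤ ENNReal.ofReal C) ∧
    (∃ C : ℝ, ∀ T, 1 ≤ T → ∀ k : ℕ,
      ENNReal.ofReal ((1 + (k : ℝ)) ^ α) * ∑' j : ℕ, dependenceCoeff P e m (g T) (k + j)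
        ≤ ENNReal.ofReal C)

/-! ### The vector autoregression in regression form

Rows of the `pd × d` parameter matrix are indexed by `(j, k) : Fin p × Fin d`, which stands for
the `k`-th coordinate at lag `j + 1`. -/

/-- `S`, the stacked transposes of `A^{(1)}, …, A^{(p)}`. -/
def paramMatrix {p d : ℕ} (A : Fin p → Matrix (Fin d) (Fin d) ℝ) :
    Matrix (Fin p × Fin d) (Fin d) ℝ :=
  Matrix.of fun jk l => A jk.1 l jk.2

/-- `S†`, the transpose of the block companion matrix. -/
def companion {p d : ℕ} (S : Matrix (Fin p × Fin d) (Fin d) ℝ) :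
    Matrix (Fin p × Fin d) (Fin p × Fin d) ℝ :=
  Matrix.of fun a b =>
    if (b.1 : ℕ) = 0 then S a b.2
    else if (a.1 : ℕ) + 1 = b.1 ∧ a.2 = b.2 then 1 else 0

/-- `z^{(t)}`, the concatenation of `x^{(t)}, x^{(t-1)}, …, x^{(t-p+1)}`. -/
def lagVector {d : ℕ} (p : ℕ) (x : ℤ → Fin d → ℝ) (t : ℤ) : Fin p × Fin d → ℝ :=
  fun jk => x (t - (jk.1 : ℕ)) jk.2

/-- `W`, whose rows are `z^{(p)}, …, z^{(T-1)}`. -/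
def designMatrix {d : ℕ} (p T : ℕ) (x : ℤ → Fin d → ℝ) :
    Matrix (Fin (T - p)) (Fin p × Fin d) ℝ :=
  Matrix.of fun k => lagVector p x ((p : ℤ) + (k : ℕ))

/-- The vector `(x^{(p+1)}_l, …, x^{(T)}_l)`; this is `y^{(l)}`, and `η^{(l)}` when applied to the
innovations. -/
def responseVector {d : ℕ} (p T : ℕ) (x : ℤ → Fin d → ℝ) (l : Fin d) : Fin (T - p) → ℝ :=
  fun k => x ((p : ℤ) + 1 + (k : ℕ)) l

/-- `B_l`, the indices of the non-zero entries of the column `S_{·l}`. -/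
def trueSupport {p d : ℕ} (S : Matrix (Fin p × Fin d) (Fin d) ℝ) (l : Fin d) :
    Finset (Fin p × Fin d) :=
  Finset.univ.filter fun j => S j l ≠ 0

/-- The indices of the entries of the column `S_{·l}` that exceed `b` in absolute value. -/
def thresholdSupport {p d : ℕ} (S : Matrix (Fin p × Fin d) (Fin d) ℝ) (b : ℝ) (l : Fin d) :
    Finset (Fin p × Fin d) :=
  Finset.univ.filter fun j => b < |S j l|

/-- The Lasso objective `(2T)⁻¹ |y^{(l)} - W s|₂² + lam |s|₁`. -/
def lassoObjective {d : ℕ} (p T : ℕ) (lam : ℝ) (x : ℤ → Fin d → ℝ) (l : Fin d)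
    (s : Fin p × Fin d → ℝ) : ℝ :=
  1 / (2 * (T : ℝ)) * l2norm (responseVector p T x l - designMatrix p T x *ᵥ s) ^ 2
    + lam * l1norm s

/-- `Σ^{(0)} = E z^{(p)} z^{(p)⊤}`. -/
def sigmaZero {Ω : Type*} [MeasurableSpace Ω] (P : Measure Ω) {d : ℕ} (p : ℕ)
    (x : ℤ → Ω → Fin d → ℝ) : Matrix (Fin p × Fin d) (Fin p × Fin d) ℝ :=
  Matrix.of fun a b =>
    ∫ ω, lagVector p (fun t => x t ω) p a * lagVector p (fun t => x t ω) p b ∂P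

/-- `T⁻¹ E W^⊤ η^{(l₁)} η^{(l₂)⊤} W`. -/
def scoreCov {Ω : Type*} [MeasurableSpace Ω] (P : Measure Ω) {d : ℕ} (p T : ℕ)
    (x eps : ℤ → Ω → Fin d → ℝ) (l₁ l₂ : Fin d) :
    Matrix (Fin p × Fin d) (Fin p × Fin d) ℝ :=
  Matrix.of fun a b => 1 / (T : ℝ) *
    ∫ ω, ((designMatrix p T fun t => x t ω)ᵀ *ᵥ responseVector p T (fun t => eps t ω) l₁) a
      * ((designMatrix p T fun t => x t ω)ᵀ *ᵥ responseVector p T (fun t => eps t ω) l₂) b ∂P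

/-- `Λ^{(l₁, l₂)}`. -/
def lambdaMatrix {Ω : Type*} [MeasurableSpace Ω] (P : Measure Ω) {d p : ℕ} (T : ℕ)
    (A : Fin p → Matrix (Fin d) (Fin d) ℝ) (x eps : ℤ → Ω → Fin d → ℝ) (l₁ l₂ : Fin d) :
    Matrix (Fin p × Fin d) (Fin p × Fin d) ℝ :=
  partialInverse (trueSupport (paramMatrix A) l₁) (sigmaZero P p x) * scoreCov P p T x eps l₁ l₂
    * partialInverse (trueSupport (paramMatrix A) l₂) (sigmaZero P p x)

end

end LassoVAR

/-! The Lasso bound is deterministic on the event that every centred sum of products `x_{t-a,i}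
x_{t-b,j}`, with lags from `0` to `p`, is at most `T κ λ`. There `WᵀW` is entrywise close to `(T -
p) Σ⁰`, whose eigenvalues are bounded below, so a restricted eigenvalue condition holds on the cone
containing the error. The score `Wᵀη` is small on the same event: since `η = y - W S`, the
population parts of `Wᵀy` and `WᵀW S` cancel by the normal equations and only centred sums of `x`
remain, weighted by `1` and by the entries of a column of `S`. The `ℓ¹` norms of the columns are
bounded, because the columns are sparse and `S_lᵀ Σ⁰ S_l ≤ E x_l²`. Thus second moments of the
innovations suffice. `lasso_l1norm_le` and `lasso_error_le` then give an `ℓ¹` error of order `λ`;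
the `ℓ²` norm is no larger, and `b_T / λ → ∞` turns the bound into support recovery.

The normal equations need the covariance of `z` to be constant in time and each innovation to be
uncorrelated with the earlier process. Both follow from stability: these moments obey linear
recursions running back in time, and a bounded solution of the homogeneous recursion vanishes
because the powers of the companion matrix tend to zero.

The event has probability tending to one by Markov's inequality with exponent `m / 2` and a union
bound over `((p + 1) d)²` sums, once each sum has `L^{m/2}` norm `O(√T)`
(`eLpNorm_sum_mul_sub_integral_le`). For this, every summand is split into martingale differences
`E[f | F_s] - E[f | F_{s-1}]`. Those at a fixed distance `j` from the time of their summand form one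
martingale difference sequence, whose sum costs `√T` times a dependence coefficient, and these
coefficients are summable in `j`. The martingale inequality comes from expanding `|S + D|^q` to
second order and iterating. Conditional expectations are realised by splicing two independent
sequences, so their properties reduce to the invariance of the product law under exchanging
coordinates. -/

namespace LassoVAR

noncomputable section

/-! ### Exchanging coordinates between two independent sequences -/

section Canonical

variable {E : Type*}

open Classical in
/-- Exchange the coordinates in `A` between the two sequences of a pair. -/
def swapCoords (A : Set ℤ) (w : (ℤ → E) × (ℤ → E)) : (ℤ → E) × (ℤ → E) :=
  (fun r => if r ∈ A then w.2 r else w.1 r, fun r => if r ∈ A then w.1 r else w.2 r)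

/-- The sequence that agrees with the first argument up to time `s` and with the second one afterwards. -/
def splice (s : ℤ) (y y' : ℤ → E) : ℤ → E := fun r => if r ≤ s then y r else y' r

theorem swapCoords_Ioi_fst (s : ℤ) (w : (ℤ → E) × (ℤ → E)) :
    (swapCoords (Set.Ioi s) w).1 = splice s w.1 w.2 := by
  funext r
  simp only [swapCoords, splice, Set.mem_Ioi]
  split_ifs <;> first | rfl | omega

/-- This lets a martingale difference, built from two splices, be compared with the dependence
coefficient, built from one replaced coordinate. -/
theorem update_swapCoords_Ioi (s : ℤ) (w : (ℤ → E) × (ℤ → E)) :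
    Function.update (swapCoords (Set.Ioi s) w).1 s ((swapCoords (Set.Ioi s) w).2 s)
      = splice (s - 1) w.1 w.2 := by
  funext r
  by_cases h : r = s
  · subst h
    simp [swapCoords, splice]
  · simp only [swapCoords, splice, Set.mem_Ioi, Function.update_of_ne h]
    split_ifs <;> first | rfl | omega

/-- Exchanging coordinate `s` alone does not affect functions of the strict past of the first
sequence; hence the orthogonality of martingale differences. -/
theorem splice_swapCoords_singleton (s : ℤ) (w : (ℤ → E) × (ℤ → E)) :
    splice s (swapCoords {s} w).1 (swapCoords {s} w).2 = splice (s - 1) w.1 w.2 := by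
  funext r
  simp only [swapCoords, splice, Set.mem_singleton_iff]
  split_ifs <;> first | rfl | omega

variable [MeasurableSpace E]

theorem measurable_swapCoords (A : Set ℤ) : Measurable (swapCoords (E := E) A) := by
  classical
  refine Measurable.prodMk (measurable_pi_lambda _ fun r => ?_) (measurable_pi_lambda _ fun r => ?_)
  · by_cases h : r ∈ A <;> simp only [h, if_true, if_false] <;> fun_prop
  · by_cases h : r ∈ A <;> simp only [h, if_true, if_false] <;> fun_prop

theorem measurable_splice (s : ℤ) :
    Measurable (fun w : (ℤ → E) × (ℤ → E) => splice s w.1 w.2) := by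
  refine measurable_pi_lambda _ fun r => ?_
  by_cases h : r ≤ s <;> simp only [splice, h, if_true, if_false] <;> fun_prop

theorem measurable_update_snd (s : ℤ) :
    Measurable (fun w : (ℤ → E) × (ℤ → E) => Function.update w.1 s (w.2 s)) := by
  refine measurable_pi_lambda _ fun r => ?_
  by_cases h : r = s
  · subst h; simp only [Function.update_self]; fun_prop
  · simp only [Function.update_of_ne h]; fun_prop

variable (ν : ℤ → Measure E)

/-- The conditional expectation of `f` given the coordinates up to time `s`. -/
def pastMean (f : (ℤ → E) → ℝ) (s : ℤ) (y : ℤ → E) : ℝ :=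
  ∫ y', f (splice s y y') ∂(Measure.infinitePi ν)

/-- The martingale difference of `f` at time `s`. -/
def pastDiff (f : (ℤ → E) → ℝ) (s : ℤ) (y : ℤ → E) : ℝ :=
  pastMean ν f s y - pastMean ν f (s - 1) y

theorem dependsOn_pastMean (f : (ℤ → E) → ℝ) (s : ℤ) :
    DependsOn (pastMean ν f s) (Set.Iic s) := by
  intro y z h
  have : ∀ y', splice s y y' = splice s z y' := fun y' => by
    funext r
    by_cases hr : r ≤ s
    · simp [splice, hr, h r hr]
    · simp [splice, hr]
  simp only [pastMean, this]

theorem dependsOn_pastDiff (f : (ℤ → E) → ℝ) (s : ℤ) :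
    DependsOn (pastDiff ν f s) (Set.Iic s) := by
  intro y z h
  have h' : ∀ i ∈ Set.Iic (s - 1), y i = z i := fun i hi =>
    h i (le_trans (Set.mem_Iic.1 hi) (by omega))
  simp only [pastDiff, dependsOn_pastMean ν f s h, dependsOn_pastMean ν f (s - 1) h']

variable [∀ i, IsProbabilityMeasure (ν i)]

/-- At each index both sequences have the same marginal and all coordinates are independent, so an
exchange only permutes equal factors. Products of finite cylinders form a generating π-system on
which this can be checked. -/
theorem measurePreserving_swapCoords (A : Set ℤ) :
    MeasurePreserving (swapCoords A) ((Measure.infinitePi ν).prod (Measure.infinitePi ν))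
      ((Measure.infinitePi ν).prod (Measure.infinitePi ν)) := by
  classical
  refine ⟨measurable_swapCoords A, ?_⟩
  set C : Set (Set (ℤ → E)) := squareCylinders fun _ => {s | MeasurableSet s} with hC
  have hgen : MeasurableSpace.generateFrom C = MeasurableSpace.pi := generateFrom_squareCylinders
  have hpi : IsPiSystem C :=
    isPiSystem_squareCylinders (fun _ => MeasurableSpace.isPiSystem_measurableSet)
      (fun _ => MeasurableSet.univ)
  have hspan : (Measure.infinitePi ν).FiniteSpanningSetsIn C :=
    { set := fun _ => Set.univ
      set_mem := fun _ => ⟨∅, fun _ => Set.univ, fun _ _ => MeasurableSet.univ, by simp⟩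
      finite := fun _ => measure_lt_top _ _
      spanning := Set.iUnion_const _ }
  symm
  refine Measure.prod_eq_generateFrom hgen hgen hpi hpi hspan hspan ?_
  rintro _ ⟨I, t, ht, rfl⟩ _ ⟨J, u, hu, rfl⟩
  simp only [Set.mem_pi, Set.mem_univ, forall_const, Set.mem_ofPred_eq] at ht hu
  -- Both cylinders are padded with full factors to a common index set, so that factors can be
  -- exchanged index by index.
  have extend : ∀ (I : Finset ℤ) (t : ℤ → Set E) (K : Finset ℤ), I ⊆ K →
      (I : Set ℤ).pi t = (K : Set ℤ).pi fun r => if r ∈ I then t r else Set.univ := by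
    intro I t K hIK
    ext y
    simp only [Set.mem_pi, Finset.mem_coe]
    constructor
    · intro h r _
      by_cases hr : r ∈ I
      · simpa [hr] using h r hr
      · simp [hr]
    · intro h r hr
      simpa [hr] using h r (hIK hr)
  rw [extend I t (I ∪ J) Finset.subset_union_left, extend J u (I ∪ J) Finset.subset_union_right]
  set K := I ∪ J
  set t' : ℤ → Set E := fun r => if r ∈ I then t r else Set.univ
  set u' : ℤ → Set E := fun r => if r ∈ J then u r else Set.univ
  have ht' : ∀ r, MeasurableSet (t' r) := fun r => by
    by_cases hr : r ∈ I <;> simp [t', hr, ht]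
  have hu' : ∀ r, MeasurableSet (u' r) := fun r => by
    by_cases hr : r ∈ J <;> simp [u', hr, hu]
  have hmeas : ∀ v : ℤ → Set E, (∀ r, MeasurableSet (v r)) →
      MeasurableSet ((K : Set ℤ).pi v) := fun v hv =>
    MeasurableSet.pi K.countable_toSet fun r _ => hv r
  rw [Measure.map_apply (measurable_swapCoords A) ((hmeas _ ht').prod (hmeas _ hu'))]
  have hpre : swapCoords A ⁻¹' ((K : Set ℤ).pi t' ×ˢ (K : Set ℤ).pi u')
      = (K : Set ℤ).pi (fun r => if r ∈ A then u' r else t' r) ×ˢ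
        (K : Set ℤ).pi (fun r => if r ∈ A then t' r else u' r) := by
    ext ⟨y, y'⟩
    simp only [Set.mem_preimage, Set.mem_prod, Set.mem_pi, swapCoords]
    rw [← forall₂_and, ← forall₂_and]
    refine forall₂_congr fun r _ => ?_
    by_cases hr : r ∈ A <;> simp [hr, and_comm]
  rw [hpre, Measure.prod_prod, Measure.infinitePi_pi, Measure.infinitePi_pi,
    Measure.infinitePi_pi, Measure.infinitePi_pi, ← Finset.prod_mul_distrib,
    ← Finset.prod_mul_distrib]
  · refine Finset.prod_congr rfl fun r _ => ?_
    by_cases hr : r ∈ A <;> simp [hr, mul_comm]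
  · exact fun r _ => hu' r
  · exact fun r _ => ht' r
  · exact fun r _ => by by_cases hr : r ∈ A <;> simp [hr, ht', hu']
  · exact fun r _ => by by_cases hr : r ∈ A <;> simp [hr, ht', hu']

theorem measurePreserving_splice (s : ℤ) :
    MeasurePreserving (fun w : (ℤ → E) × (ℤ → E) => splice s w.1 w.2)
      ((Measure.infinitePi ν).prod (Measure.infinitePi ν)) (Measure.infinitePi ν) := by
  have h := measurePreserving_fst.comp (measurePreserving_swapCoords ν (Set.Ioi s))
  have e : (Prod.fst ∘ swapCoords (Set.Ioi s)) =
      fun w : (ℤ → E) × (ℤ → E) => splice s w.1 w.2 := funext fun w => swapCoords_Ioi_fst s w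
  rwa [e] at h

theorem measurePreserving_update_snd (s : ℤ) :
    MeasurePreserving (fun w : (ℤ → E) × (ℤ → E) => Function.update w.1 s (w.2 s))
      ((Measure.infinitePi ν).prod (Measure.infinitePi ν)) (Measure.infinitePi ν) := by
  have h := measurePreserving_fst.comp (measurePreserving_swapCoords ν {s})
  have e : (Prod.fst ∘ swapCoords {s}) =
      fun w : (ℤ → E) × (ℤ → E) => Function.update w.1 s (w.2 s) := by
    funext w r
    by_cases hr : r = s
    · subst hr; simp [swapCoords]
    · simp [swapCoords, hr]
  rwa [e] at h

/-! ### Conditional expectations given the past -/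

theorem measurable_pastMean {f : (ℤ → E) → ℝ} (hf : Measurable f) (s : ℤ) :
    Measurable (pastMean ν f s) := by
  have : StronglyMeasurable (Function.uncurry fun y y' : ℤ → E => f (splice s y y')) :=
    (hf.comp (measurable_splice s)).stronglyMeasurable
  exact this.integral_prod_right.measurable

theorem measurable_pastDiff {f : (ℤ → E) → ℝ} (hf : Measurable f) (s : ℤ) :
    Measurable (pastDiff ν f s) :=
  (measurable_pastMean ν hf s).sub (measurable_pastMean ν hf (s - 1))

theorem pastMean_eq_self {f : (ℤ → E) → ℝ} {s : ℤ} (hf : DependsOn f (Set.Iic s)) :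
    pastMean ν f s = f := by
  funext y
  have : ∀ y', f (splice s y y') = f y := fun y' =>
    hf fun r hr => by simp [splice, Set.mem_Iic.1 hr]
  simp [pastMean, this]

/-- Integrating out the second variable does not increase the `L^q` norm. -/
theorem eLpNorm_integral_snd_le {X : Type*} [MeasurableSpace X] (μ : Measure X)
    [IsProbabilityMeasure μ] {F : X × X → ℝ} (hF : Measurable F) {q : ℝ≥0∞} (hq : 1 ≤ q)
    (hq' : q ≠ ∞) :
    eLpNorm (fun y => ∫ y', F (y, y') ∂μ) q μ ≤ eLpNorm F q (μ.prod μ) := by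
  have hq0 : q ≠ 0 := (zero_lt_one.trans_le hq).ne'
  have hqr : 0 < q.toReal := ENNReal.toReal_pos hq0 hq'
  rw [eLpNorm_eq_lintegral_rpow_enorm_toReal hq0 hq', eLpNorm_eq_lintegral_rpow_enorm_toReal hq0 hq']
  refine ENNReal.rpow_le_rpow ?_ (by positivity)
  rw [lintegral_prod _ (by fun_prop)]
  refine lintegral_mono fun y => ?_
  -- Jensen's inequality in two moves: the triangle inequality for the integral, then monotonicity
  -- of `L^q` norms on a probability space.
  have h1 : ‖∫ y', F (y, y') ∂μ‖ₑ ≤ eLpNorm (fun y' => F (y, y')) 1 μ := by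
    rw [eLpNorm_one_eq_lintegral_enorm]
    exact enorm_integral_le_lintegral_enorm _
  have h2 : eLpNorm (fun y' => F (y, y')) 1 μ ≤ eLpNorm (fun y' => F (y, y')) q μ :=
    eLpNorm_le_eLpNorm_of_exponent_le hq
      (hF.comp measurable_prodMk_left).aestronglyMeasurable
  refine (ENNReal.rpow_le_rpow (h1.trans h2) hqr.le).trans ?_
  rw [eLpNorm_eq_lintegral_rpow_enorm_toReal hq0 hq', ← ENNReal.rpow_mul,
    one_div_mul_cancel hqr.ne', ENNReal.rpow_one]

variable {ν}

theorem memLp_pastMean {f : (ℤ → E) → ℝ} (hf : Measurable f) {q : ℝ≥0∞} (hq : 1 ≤ q)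
    (hq' : q ≠ ∞) (hfq : MemLp f q (Measure.infinitePi ν)) (s : ℤ) :
    MemLp (pastMean ν f s) q (Measure.infinitePi ν) := by
  refine ⟨(measurable_pastMean ν hf s).aestronglyMeasurable, ?_⟩
  refine (eLpNorm_integral_snd_le _ (F := fun w => f (splice s w.1 w.2))
    (hf.comp (measurable_splice s)) hq hq').trans_lt ?_
  exact (hfq.comp_measurePreserving (measurePreserving_splice ν s)).2

theorem memLp_pastDiff {f : (ℤ → E) → ℝ} (hf : Measurable f) {q : ℝ≥0∞} (hq : 1 ≤ q)
    (hq' : q ≠ ∞) (hfq : MemLp f q (Measure.infinitePi ν)) (s : ℤ) :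
    MemLp (pastDiff ν f s) q (Measure.infinitePi ν) :=
  (memLp_pastMean hf hq hq' hfq s).sub (memLp_pastMean hf hq hq' hfq (s - 1))

theorem integrable_comp_splice {f : (ℤ → E) → ℝ} (hfi : Integrable f (Measure.infinitePi ν))
    (s : ℤ) : Integrable (fun w : (ℤ → E) × (ℤ → E) => f (splice s w.1 w.2))
      ((Measure.infinitePi ν).prod (Measure.infinitePi ν)) :=
  (measurePreserving_splice ν s).integrable_comp_of_integrable hfi

theorem pastDiff_ae_eq {f : (ℤ → E) → ℝ} (hfi : Integrable f (Measure.infinitePi ν)) (s : ℤ) :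
    pastDiff ν f s =ᵐ[Measure.infinitePi ν] fun y =>
      ∫ y', (f (splice s y y') - f (splice (s - 1) y y')) ∂(Measure.infinitePi ν) := by
  filter_upwards [(integrable_comp_splice hfi s).prod_right_ae,
    (integrable_comp_splice hfi (s - 1)).prod_right_ae] with y h1 h2
  rw [integral_sub h1 h2]
  rfl

/-- The `L^q` norm of a martingale difference is at most the effect of replacing the coordinate
`s` by an independent copy. -/
theorem eLpNorm_pastDiff_le {f : (ℤ → E) → ℝ} (hf : Measurable f)
    (hfi : Integrable f (Measure.infinitePi ν)) {q : ℝ≥0∞} (hq : 1 ≤ q) (hq' : q ≠ ∞) (s : ℤ) :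
    eLpNorm (pastDiff ν f s) q (Measure.infinitePi ν) ≤
      eLpNorm (fun w : (ℤ → E) × (ℤ → E) => f w.1 - f (Function.update w.1 s (w.2 s))) q
        ((Measure.infinitePi ν).prod (Measure.infinitePi ν)) := by
  have hF : Measurable fun w : (ℤ → E) × (ℤ → E) =>
      f w.1 - f (Function.update w.1 s (w.2 s)) :=
    (hf.comp measurable_fst).sub (hf.comp (measurable_update_snd s))
  -- Exchanging all coordinates after `s` preserves the law and turns the replacement of coordinate
  -- `s` into the difference of two splices, whose average over the second sequence is the
  -- martingale difference.
  rw [eLpNorm_congr_ae (pastDiff_ae_eq hfi s),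
    ← eLpNorm_comp_measurePreserving hF.aestronglyMeasurable
      (measurePreserving_swapCoords ν (Set.Ioi s))]
  refine (eLpNorm_integral_snd_le _
    (F := fun w => f (splice s w.1 w.2) - f (splice (s - 1) w.1 w.2))
    ((hf.comp (measurable_splice s)).sub (hf.comp (measurable_splice (s - 1)))) hq hq').trans
    (le_of_eq ?_)
  congr 1
  funext w
  simp only [Function.comp_apply]
  rw [update_swapCoords_Ioi, swapCoords_Ioi_fst]

/-- The martingale difference at time `s` is orthogonal to functions of the past of `s`. -/
theorem integral_mul_pastDiff_eq_zero {f φ : (ℤ → E) → ℝ}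
    (hfi : Integrable f (Measure.infinitePi ν)) {s : ℤ}
    (hφ : DependsOn φ (Set.Iic (s - 1)))
    (h1 : Integrable (fun w : (ℤ → E) × (ℤ → E) => φ w.1 * f (splice s w.1 w.2))
      ((Measure.infinitePi ν).prod (Measure.infinitePi ν)))
    (h2 : Integrable (fun w : (ℤ → E) × (ℤ → E) => φ w.1 * f (splice (s - 1) w.1 w.2))
      ((Measure.infinitePi ν).prod (Measure.infinitePi ν))) :
    ∫ y, φ y * pastDiff ν f s y ∂(Measure.infinitePi ν) = 0 := by
  set μ := Measure.infinitePi ν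
  have e1 : ∫ y, φ y * pastDiff ν f s y ∂μ =
      ∫ w, (φ w.1 * f (splice s w.1 w.2) - φ w.1 * f (splice (s - 1) w.1 w.2)) ∂(μ.prod μ) := by
    refine Eq.trans ?_ (integral_prod _ (h1.sub h2)).symm
    refine integral_congr_ae ?_
    filter_upwards [pastDiff_ae_eq hfi s] with y hy
    rw [hy, ← integral_const_mul]
    simp only [mul_sub, Pi.sub_apply]
    rfl
  have hswap := measurePreserving_swapCoords ν {s}
  -- Exchanging coordinate `s` alone carries one integrand to the other, since `φ` only sees times
  -- before `s`.
  have e2 : ∫ w, φ w.1 * f (splice s w.1 w.2) ∂(μ.prod μ) =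
      ∫ w, φ w.1 * f (splice (s - 1) w.1 w.2) ∂(μ.prod μ) := by
    conv_lhs => rw [← hswap.map_eq]
    rw [integral_map hswap.measurable.aemeasurable
      (by rw [hswap.map_eq]; exact h1.aestronglyMeasurable)]
    refine integral_congr_ae (Eventually.of_forall fun w => ?_)
    simp only [splice_swapCoords_singleton]
    congr 1
    refine hφ fun r hr => ?_
    have : r ≠ s := by have := Set.mem_Iic.1 hr; omega
    simp [swapCoords, this]
  rw [e1, integral_sub h1 h2, e2, sub_self]

/-- Conditional expectations given the remote past converge to the mean. -/
theorem tendsto_eLpNorm_pastMean {f : (ℤ → E) → ℝ} (hf : Measurable f)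
    (hfi : Integrable f (Measure.infinitePi ν)) (c : ℤ) :
    Tendsto (fun n : ℕ => eLpNorm (fun y => pastMean ν f (c - n) y
      - ∫ y', f y' ∂(Measure.infinitePi ν)) 1 (Measure.infinitePi ν)) atTop (𝓝 0) := by
  set μ := Measure.infinitePi ν with hμ
  -- The coordinates after `c - n` generate σ-algebras that increase to the full one, so the upward
  -- Lévy theorem applies in place of a limit along the decreasing remote past.
  let ℱ : Filtration ℕ (MeasurableSpace.pi : MeasurableSpace (ℤ → E)) :=
    { seq := fun n => cylinderEvents (Set.Ioi (c - n))
      mono' := fun n k hnk => cylinderEvents_mono (Set.Ioi_subset_Ioi (by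
        have : (n : ℤ) ≤ k := by exact_mod_cast hnk
        omega))
      le' := fun n => cylinderEvents_le_pi }
  have hsup : (⨆ n, ℱ n) = (MeasurableSpace.pi : MeasurableSpace (ℤ → E)) := by
    refine le_antisymm (iSup_le fun n => ℱ.le n) ?_
    refine iSup_le fun r => ?_
    refine le_trans ?_ (le_iSup _ (c - r + 1).toNat)
    have hr : r ∈ Set.Ioi (c - ((c - r + 1).toNat : ℤ)) := by
      simp only [Set.mem_Ioi]; omega
    exact le_iSup₂_of_le (f := fun i (_ : i ∈ Set.Ioi (c - ((c - r + 1).toNat : ℤ))) =>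
      MeasurableSpace.comap (fun σ : ℤ → E => σ i) inferInstance) r hr le_rfl
  have hlevy : Tendsto (fun n => eLpNorm (μ[f | ℱ n] - f) 1 μ) atTop (𝓝 0) := by
    refine hfi.tendsto_eLpNorm_condExp ?_
    rw [hsup]
    exact hf.stronglyMeasurable
  have hbound : ∀ n : ℕ, eLpNorm (fun y => pastMean ν f (c - n) y - ∫ y', f y' ∂μ) 1 μ ≤
      2 * eLpNorm (μ[f | ℱ n] - f) 1 μ := by
    intro n
    set V := μ[f | ℱ n] with hV
    have hVm : Measurable V := (stronglyMeasurable_condExp.mono (ℱ.le n)).measurable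
    have hVdep : DependsOn V (Set.Ioi (c - (n : ℤ))) := by
      have h0 : StronglyMeasurable[cylinderEvents (Set.Ioi (c - (n : ℤ)))] V :=
        stronglyMeasurable_condExp
      have h1 : Measurable[cylinderEvents (Set.Ioi (c - (n : ℤ)))] V := h0.measurable
      have hle : cylinderEvents (X := fun _ : ℤ => E) (Set.Ioi (c - (n : ℤ))) ≤
          (MeasurableSpace.pi : MeasurableSpace (Set.Ioi (c - (n : ℤ)) → E)).comap
            (Set.domRestrict (Set.Ioi (c - (n : ℤ)))) :=
        iSup₂_le fun i hi => by
          rw [show (fun σ : ℤ → E => σ i) = (fun σ : Set.Ioi (c - (n : ℤ)) → E => σ ⟨i, hi⟩) ∘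
            Set.domRestrict (Set.Ioi (c - (n : ℤ))) from rfl, ← MeasurableSpace.comap_comp]
          exact MeasurableSpace.comap_mono (measurable_pi_apply
            (X := fun _ : Set.Ioi (c - (n : ℤ)) => E) ⟨i, hi⟩).comap_le
      exact dependsOn_iff_factorsThrough.2 (h1.mono hle le_rfl).factorsThrough
    have hVs : ∀ y y', V (splice (c - (n : ℤ)) y y') = V y' := fun y y' =>
      hVdep fun r hr => by
        have : ¬ r ≤ c - (n : ℤ) := not_le.2 hr
        simp [splice, this]
    have hFm : Measurable fun w : (ℤ → E) × (ℤ → E) =>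
        f (splice (c - (n : ℤ)) w.1 w.2) - f w.2 :=
      (hf.comp (measurable_splice _)).sub (hf.comp measurable_snd)
    have hae : (fun y => pastMean ν f (c - n) y - ∫ y', f y' ∂μ) =ᵐ[μ] fun y =>
        ∫ y', (f (splice (c - (n : ℤ)) y y') - f y') ∂μ := by
      filter_upwards [(integrable_comp_splice hfi (c - (n : ℤ))).prod_right_ae] with y h1
      rw [integral_sub h1 hfi]
      rfl
    rw [eLpNorm_congr_ae hae]
    refine (eLpNorm_integral_snd_le μ hFm le_rfl ENNReal.one_ne_top).trans ?_
    -- `V` takes the same value at the splice and at the second sequence, so it cancels. Both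
    -- arguments have law `μ`, which produces the factor `2`.
    have hsplit : (fun w : (ℤ → E) × (ℤ → E) => f (splice (c - (n : ℤ)) w.1 w.2) - f w.2) =
        ((V - f) ∘ Prod.snd) -
          ((V - f) ∘ fun w : (ℤ → E) × (ℤ → E) => splice (c - (n : ℤ)) w.1 w.2) := by
      funext w
      simp only [Pi.sub_apply, Function.comp_apply, hVs]
      ring
    have hVf : AEStronglyMeasurable (V - f) μ := (hVm.sub hf).aestronglyMeasurable
    rw [hsplit]
    refine (eLpNorm_sub_le (hVf.comp_measurePreserving measurePreserving_snd)
      (hVf.comp_measurePreserving (measurePreserving_splice ν _)) le_rfl).trans (le_of_eq ?_)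
    rw [eLpNorm_comp_measurePreserving hVf measurePreserving_snd,
      eLpNorm_comp_measurePreserving hVf (measurePreserving_splice ν _), two_mul]
  have hlim : Tendsto (fun n => 2 * eLpNorm (μ[f | ℱ n] - f) 1 μ) atTop (𝓝 0) := by
    have := ENNReal.Tendsto.const_mul hlevy (a := 2) (Or.inr (by simp))
    simpa using this
  exact tendsto_of_tendsto_of_tendsto_of_le_of_le tendsto_const_nhds hlim (fun _ => zero_le) hbound

end Canonical

/-! ### A moment inequality for martingale differences -/

/-- Convexity: the tangent of the power function at `w` lies below its graph at `1`. The proof is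
Bernoulli's inequality at `w⁻¹`, multiplied by `w ^ q`. -/
theorem rpow_le_one_add_mul {w q : ℝ} (hw : 0 < w) (hq : 1 ≤ q) :
    w ^ q ≤ 1 + q * (w - 1) * w ^ (q - 1) := by
  have h := one_add_mul_self_le_rpow_one_add (s := w⁻¹ - 1) (by have := inv_pos.2 hw; linarith) hq
  rw [add_sub_cancel, Real.inv_rpow hw.le] at h
  have hwq : 0 < w ^ q := Real.rpow_pos_of_pos hw q
  have h2 := mul_le_mul_of_nonneg_right h hwq.le
  rw [inv_mul_cancel₀ hwq.ne'] at h2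
  have h3 : w ^ q = w ^ (q - 1) * w := by
    rw [Real.rpow_sub_one hw.ne', div_mul_cancel₀ _ hw.ne']
  have h4 : w⁻¹ * w ^ q = w ^ (q - 1) := by
    rw [h3]; field_simp
  nlinarith

/-- The constant in the second order expansion of `|x + y| ^ q`. -/
def expandConst (q : ℝ) : ℝ := 3 ^ q + 2 * q + q * (q - 1) * 2 ^ q

theorem one_le_expandConst {q : ℝ} (hq : 2 ≤ q) : 1 ≤ expandConst q := by
  have h1 : (0 : ℝ) < 3 ^ q := by positivity
  have h2 : 0 ≤ q * (q - 1) * 2 ^ q := by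
    have : 0 ≤ q - 1 := by linarith
    positivity
  unfold expandConst
  linarith

/-- For `|u| ≥ 1/2` size alone suffices: `|1 + u| ≤ 3|u|` accounts for `3 ^ q`, and absorbing `q u`
into `u ^ 2` for `2 q`. For smaller `u`, convexity leaves the remainder `q u ((1 + u) ^ (q - 1) -
1)`, which is of second order with constant `q (q - 1) 2 ^ q`. -/
theorem abs_one_add_rpow_le {q : ℝ} (hq : 2 ≤ q) (u : ℝ) :
    |1 + u| ^ q ≤ 1 + q * u + expandConst q * (u ^ 2 + |u| ^ q) := by
  have h3q : (0 : ℝ) < 3 ^ q := by positivity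
  have h2q : (0 : ℝ) < 2 ^ q := by positivity
  have huq : 0 ≤ |u| ^ q := by positivity
  have hqq : 0 ≤ q * (q - 1) * 2 ^ q := by
    have : 0 ≤ q - 1 := by linarith
    positivity
  unfold expandConst
  rcases le_or_gt (1 / 2) |u| with h | h
  · have e1 : |1 + u| ^ q ≤ 3 ^ q * |u| ^ q := by
      rw [← Real.mul_rpow (by norm_num) (abs_nonneg u)]
      refine Real.rpow_le_rpow (abs_nonneg _) ?_ (by linarith)
      have := abs_add_le 1 u
      rw [abs_one] at this
      linarith
    have e2 : |u| ≤ 2 * u ^ 2 := by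
      rw [← sq_abs u]; nlinarith [abs_nonneg u]
    have e3 : -(q * u) ≤ 2 * q * u ^ 2 := by
      have := neg_abs_le u
      nlinarith
    nlinarith [mul_nonneg hqq (sq_nonneg u), mul_nonneg hqq huq, mul_nonneg h3q.le (sq_nonneg u),
      mul_nonneg (by linarith : (0 : ℝ) ≤ 2 * q) huq]
  · have hu := abs_lt.1 h
    have hw : 0 < 1 + u := by linarith [hu.1]
    rw [abs_of_pos hw]
    have e1 := rpow_le_one_add_mul hw (q := q) (by linarith)
    rw [add_sub_cancel_left] at e1
    have e2 : u * ((1 + u) ^ (q - 1) - 1) ≤ (q - 1) * 2 ^ q * u ^ 2 := by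
      have h2q1 : (1 : ℝ) ≤ 2 ^ q := Real.one_le_rpow (by norm_num) (by linarith)
      rcases le_or_gt 0 u with hu0 | hu0
      · have e3 := rpow_le_one_add_mul hw (q := q - 1) (by linarith)
        rw [add_sub_cancel_left] at e3
        have e4 : (1 + u) ^ (q - 1 - 1) ≤ 2 ^ q :=
          (Real.rpow_le_rpow_of_exponent_le (by linarith) (by linarith)).trans
            (Real.rpow_le_rpow hw.le (by linarith [hu.2]) (by linarith))
        have e5 : (1 + u) ^ (q - 1) - 1 ≤ (q - 1) * u * 2 ^ q := by
          have := mul_le_mul_of_nonneg_left e4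
            (mul_nonneg (by linarith : (0 : ℝ) ≤ q - 1) hu0)
          linarith
        calc u * ((1 + u) ^ (q - 1) - 1) ≤ u * ((q - 1) * u * 2 ^ q) :=
              mul_le_mul_of_nonneg_left e5 hu0
          _ = _ := by ring
      · have e3 := one_add_mul_self_le_rpow_one_add (s := u) (by linarith [hu.1])
          (p := q - 1) (by linarith)
        have e4 : u * ((1 + u) ^ (q - 1) - 1) ≤ u * ((q - 1) * u) :=
          mul_le_mul_of_nonpos_left (by linarith) hu0.le
        have e5 : (q - 1) * u ^ 2 * 1 ≤ (q - 1) * u ^ 2 * 2 ^ q :=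
          mul_le_mul_of_nonneg_left h2q1 (mul_nonneg (by linarith) (sq_nonneg u))
        nlinarith
    have e6 : q * (u * ((1 + u) ^ (q - 1) - 1)) ≤ q * ((q - 1) * 2 ^ q * u ^ 2) :=
      mul_le_mul_of_nonneg_left e2 (by linarith)
    have e7 : 0 ≤ (3 ^ q + 2 * q) * (u ^ 2 + |u| ^ q) := by positivity
    have e8 : 0 ≤ q * (q - 1) * 2 ^ q * |u| ^ q := by positivity
    nlinarith

theorem abs_rpow_sub_two_mul_sq {q : ℝ} (hq : 2 ≤ q) (x : ℝ) :
    |x| ^ (q - 2) * x ^ 2 = |x| ^ q := by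
  rcases eq_or_ne x 0 with rfl | hx
  · simp [Real.zero_rpow (by linarith : q ≠ 0)]
  · rw [← sq_abs x, ← Real.rpow_natCast |x| 2, ← Real.rpow_add (abs_pos.2 hx)]
    norm_num

theorem abs_add_rpow_le {q : ℝ} (hq : 2 ≤ q) (x y : ℝ) :
    |x + y| ^ q ≤ |x| ^ q + q * (|x| ^ (q - 2) * x * y)
      + expandConst q * (|x| ^ (q - 2) * y ^ 2 + |y| ^ q) := by
  have hC := one_le_expandConst hq
  rcases eq_or_ne x 0 with rfl | hx
  · have h1 : 0 ≤ |(0 : ℝ)| ^ (q - 2) * y ^ 2 := by positivity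
    have h2 : 0 ≤ |y| ^ q := by positivity
    have h3 : |(0 : ℝ)| ^ q = 0 := by rw [abs_zero, Real.zero_rpow (by linarith)]
    rw [h3, zero_add]
    nlinarith
  · set u := y / x with hu
    have hy : y = x * u := by rw [hu]; field_simp
    have h := mul_le_mul_of_nonneg_left (abs_one_add_rpow_le hq u)
      (by positivity : 0 ≤ |x| ^ q)
    have e1 : |x + y| ^ q = |x| ^ q * |1 + u| ^ q := by
      rw [← Real.mul_rpow (abs_nonneg _) (abs_nonneg _), ← abs_mul, hy]; ring_nf
    have e2 : |y| ^ q = |x| ^ q * |u| ^ q := by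
      rw [← Real.mul_rpow (abs_nonneg _) (abs_nonneg _), ← abs_mul, hy]
    have e3 : |x| ^ (q - 2) * x * y = |x| ^ q * u := by
      rw [← abs_rpow_sub_two_mul_sq hq x, hy]; ring
    have e4 : |x| ^ (q - 2) * y ^ 2 = |x| ^ q * u ^ 2 := by
      rw [← abs_rpow_sub_two_mul_sq hq x, hy]; ring
    rw [e1, e2, e3, e4]
    linarith

/-- A Young-type splitting, by comparing `|x|` with `√N |y|`. With weight `1 / N` on `|x| ^ q`, a
recursion of `N` steps grows only by a bounded factor. -/
theorem abs_rpow_sub_two_mul_sq_le {q N : ℝ} (hq : 2 ≤ q) (hN : 0 < N) (x y : ℝ) :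
    |x| ^ (q - 2) * y ^ 2 ≤ |x| ^ q / N + N ^ (q / 2 - 1) * |y| ^ q := by
  have hs : 0 < √N := Real.sqrt_pos.2 hN
  have hsN : √N ^ (q - 2) = N ^ (q / 2 - 1) := by
    rw [Real.sqrt_eq_rpow, ← Real.rpow_mul hN.le]; ring_nf
  rcases le_or_gt |x| (√N * |y|) with h | h
  · have e1 : |x| ^ (q - 2) ≤ N ^ (q / 2 - 1) * |y| ^ (q - 2) := by
      rw [← hsN, ← Real.mul_rpow hs.le (abs_nonneg y)]
      exact Real.rpow_le_rpow (abs_nonneg _) h (by linarith)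
    have e2 := mul_le_mul_of_nonneg_right e1 (sq_nonneg y)
    rw [mul_assoc, abs_rpow_sub_two_mul_sq hq] at e2
    have : 0 ≤ |x| ^ q / N := by positivity
    linarith
  · have e1 : y ^ 2 ≤ x ^ 2 / N := by
      rw [le_div_iff₀ hN, ← sq_abs x, ← sq_abs y]
      calc |y| ^ 2 * N = (√N * |y|) ^ 2 := by rw [mul_pow, Real.sq_sqrt hN.le]; ring
        _ ≤ |x| ^ 2 := pow_le_pow_left₀ (by positivity) h.le 2
    have e2 := mul_le_mul_of_nonneg_left e1 (by positivity : 0 ≤ |x| ^ (q - 2))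
    rw [← mul_div_assoc, abs_rpow_sub_two_mul_sq hq] at e2
    have : 0 ≤ N ^ (q / 2 - 1) * |y| ^ q := by positivity
    linarith

theorem abs_add_rpow_le_of_one_le {q N : ℝ} (hq : 2 ≤ q) (hN : 1 ≤ N) (x y : ℝ) :
    |x + y| ^ q ≤ (1 + expandConst q / N) * |x| ^ q + q * (|x| ^ (q - 2) * x * y)
      + 2 * expandConst q * N ^ (q / 2 - 1) * |y| ^ q := by
  have hC := one_le_expandConst hq
  have h1 := abs_add_rpow_le hq x y
  have h2 := abs_rpow_sub_two_mul_sq_le hq (by linarith : 0 < N) x y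
  have h3 : |y| ^ q ≤ N ^ (q / 2 - 1) * |y| ^ q :=
    le_mul_of_one_le_left (by positivity) (Real.one_le_rpow hN (by linarith))
  have h4 := mul_le_mul_of_nonneg_left (add_le_add h2 h3) (by linarith : 0 ≤ expandConst q)
  have h5 : expandConst q / N * |x| ^ q = expandConst q * (|x| ^ q / N) := by ring
  rw [add_mul, h5]
  linarith

theorem abs_rpow_sub_two_mul_mul_le {q : ℝ} (hq : 2 ≤ q) (x y : ℝ) :
    |(|x| ^ (q - 2) * x) * y| ≤ |x| ^ q + |y| ^ q := by
  have hmul : ∀ a : ℝ, |a| ^ (q - 2) * |a| * |a| = |a| ^ q := fun a => by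
    rw [← abs_rpow_sub_two_mul_sq hq a, ← sq_abs a]; ring
  rw [abs_mul, abs_mul, abs_of_nonneg (by positivity : 0 ≤ |x| ^ (q - 2))]
  rcases le_total |x| |y| with h | h
  · have e1 : |x| ^ (q - 2) ≤ |y| ^ (q - 2) :=
      Real.rpow_le_rpow (abs_nonneg _) h (by linarith)
    have e2 : |x| ^ (q - 2) * |x| * |y| ≤ |y| ^ (q - 2) * |y| * |y| := by gcongr
    rw [hmul] at e2
    have : 0 ≤ |x| ^ q := by positivity
    linarith
  · have e2 : |x| ^ (q - 2) * |x| * |y| ≤ |x| ^ (q - 2) * |x| * |x| := by gcongr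
    rw [hmul] at e2
    have : 0 ≤ |y| ^ q := by positivity
    linarith

theorem integrable_abs_rpow {X : Type*} [MeasurableSpace X] {μ : Measure X} {q : ℝ} (hq : 0 < q)
    {S : X → ℝ} (hS : MemLp S (ENNReal.ofReal q) μ) : Integrable (fun y => |S y| ^ q) μ := by
  have := hS.integrable_norm_rpow (by simpa using hq) (by simp)
  simpa [ENNReal.toReal_ofReal hq.le] using this

theorem integral_abs_add_rpow_le {X : Type*} [MeasurableSpace X] {μ : Measure X} {q N : ℝ}
    (hq : 2 ≤ q) (hN : 1 ≤ N) {S D : X → ℝ} (hS : MemLp S (ENNReal.ofReal q) μ)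
    (hD : MemLp D (ENNReal.ofReal q) μ)
    (horth : ∫ y, (|S y| ^ (q - 2) * S y) * D y ∂μ = 0) :
    ∫ y, |S y + D y| ^ q ∂μ ≤ (1 + expandConst q / N) * ∫ y, |S y| ^ q ∂μ
      + 2 * expandConst q * N ^ (q / 2 - 1) * ∫ y, |D y| ^ q ∂μ := by
  have hq0 : 0 < q := by linarith
  have iS := integrable_abs_rpow hq0 hS
  have iD := integrable_abs_rpow hq0 hD
  have iSD := integrable_abs_rpow hq0 (hS.add hD)
  have iX : Integrable (fun y => (|S y| ^ (q - 2) * S y) * D y) μ := by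
    refine (iS.add iD).mono' ?_ (Eventually.of_forall fun y => ?_)
    · refine AEStronglyMeasurable.mul (AEStronglyMeasurable.mul ?_ hS.1) hD.1
      exact ((hS.1.aemeasurable.abs).pow_const _).aestronglyMeasurable
    · exact abs_rpow_sub_two_mul_mul_le hq _ _
  have h1 : ∫ y, |S y + D y| ^ q ∂μ ≤ ∫ y, ((1 + expandConst q / N) * |S y| ^ q
      + q * ((|S y| ^ (q - 2) * S y) * D y)
      + 2 * expandConst q * N ^ (q / 2 - 1) * |D y| ^ q) ∂μ :=
    integral_mono iSD (((iS.const_mul _).add (iX.const_mul _)).add (iD.const_mul _))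
      fun y => abs_add_rpow_le_of_one_le hq hN _ _
  refine h1.trans (le_of_eq ?_)
  have iSX : Integrable (fun y => (1 + expandConst q / N) * |S y| ^ q
      + q * ((|S y| ^ (q - 2) * S y) * D y)) μ := (iS.const_mul _).add (iX.const_mul _)
  rw [integral_add iSX (iD.const_mul _), integral_add (iS.const_mul _) (iX.const_mul _), integral_const_mul, integral_const_mul,
    integral_const_mul, horth]
  ring

section Martingale

variable {E : Type*} [MeasurableSpace E] {ν : ℤ → Measure E} [∀ i, IsProbabilityMeasure (ν i)]

/-- The linear term of the expansion of `|S + D| ^ q` has mean zero, because its coefficient is a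
function of the strict past. -/
theorem integral_rpow_mul_pastDiff_eq_zero {q : ℝ} (hq : 2 ≤ q) {S f : (ℤ → E) → ℝ} {s : ℤ}
    (hSm : Measurable S) (hS : MemLp S (ENNReal.ofReal q) (Measure.infinitePi ν))
    (hSdep : DependsOn S (Set.Iic (s - 1))) (hf : Measurable f)
    (hfq : MemLp f (ENNReal.ofReal q) (Measure.infinitePi ν)) :
    ∫ y, (|S y| ^ (q - 2) * S y) * pastDiff ν f s y ∂(Measure.infinitePi ν) = 0 := by
  have hq0 : 0 < q := by linarith
  have hq1 : 1 ≤ ENNReal.ofReal q := by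
    rw [ENNReal.one_le_ofReal]; linarith
  have hint : ∀ r : ℤ, Integrable (fun w : (ℤ → E) × (ℤ → E) =>
      (|S w.1| ^ (q - 2) * S w.1) * f (splice r w.1 w.2))
      ((Measure.infinitePi ν).prod (Measure.infinitePi ν)) := by
    intro r
    have i1 := integrable_abs_rpow hq0 (hS.comp_measurePreserving
      (measurePreserving_fst (μ := Measure.infinitePi ν) (ν := Measure.infinitePi ν)))
    have i2 := integrable_abs_rpow hq0 (hfq.comp_measurePreserving (measurePreserving_splice ν r))
    refine (i1.add i2).mono' ?_ (Eventually.of_forall fun w => ?_)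
    · have m1 : Measurable fun w : (ℤ → E) × (ℤ → E) => S w.1 := hSm.comp measurable_fst
      have m2 : Measurable fun w : (ℤ → E) × (ℤ → E) => f (splice r w.1 w.2) :=
        hf.comp (measurable_splice r)
      exact (((m1.abs.pow_const _).mul m1).mul m2).aestronglyMeasurable
    · exact abs_rpow_sub_two_mul_mul_le hq _ _
  refine integral_mul_pastDiff_eq_zero (φ := fun y => |S y| ^ (q - 2) * S y)
    (hfq.integrable hq1) ?_ (hint s) (hint (s - 1))
  intro y z h
  simp only [hSdep h]

/-- The constant of the moment inequality for sums of martingale differences. -/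
def momentConst (q : ℝ) : ℝ := (Real.exp (expandConst q) * (2 * expandConst q)) ^ (1 / q)

theorem momentConst_pos {q : ℝ} (hq : 2 ≤ q) : 0 < momentConst q := by
  have := one_le_expandConst hq
  unfold momentConst
  positivity

theorem integral_abs_sum_pastDiff_rpow_le {q : ℝ} (hq : 2 ≤ q) (f : ℕ → (ℤ → E) → ℝ)
    (hf : ∀ k, Measurable (f k))
    (hfq : ∀ k, MemLp (f k) (ENNReal.ofReal q) (Measure.infinitePi ν)) (c : ℤ) {n : ℕ}
    (hn : 1 ≤ n) {B : ℝ}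
    (hB : ∀ k, ∫ y, |pastDiff ν (f k) (c + k) y| ^ q ∂(Measure.infinitePi ν) ≤ B) (k : ℕ) :
    ∫ y, |∑ t ∈ Finset.range k, pastDiff ν (f t) (c + t) y| ^ q ∂(Measure.infinitePi ν) ≤
      (1 + expandConst q / n) ^ k * (k * (2 * expandConst q * (n : ℝ) ^ (q / 2 - 1) * B)) := by
  have hC := one_le_expandConst hq
  have hn' : (1 : ℝ) ≤ n := by exact_mod_cast hn
  have hB0 : 0 ≤ B := (integral_nonneg fun y => by positivity).trans (hB 0)
  have hq1 : 1 ≤ ENNReal.ofReal q := by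
    rw [ENNReal.one_le_ofReal]; linarith
  have hD : ∀ t, MemLp (pastDiff ν (f t) (c + t)) (ENNReal.ofReal q) (Measure.infinitePi ν) :=
    fun t => memLp_pastDiff (hf t) hq1 (by simp) (hfq t) _
  induction k with
  | zero => simp [Real.zero_rpow (by linarith : q ≠ 0)]
  | succ k ih =>
    simp only [Finset.sum_range_succ]
    have hS : MemLp (fun y => ∑ t ∈ Finset.range k, pastDiff ν (f t) (c + t) y)
        (ENNReal.ofReal q) (Measure.infinitePi ν) :=
      memLp_finsetSum _ fun t _ => hD t
    have hSm : Measurable fun y => ∑ t ∈ Finset.range k, pastDiff ν (f t) (c + t) y :=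
      Finset.measurable_sum _ fun t _ => measurable_pastDiff ν (hf t) _
    have hSdep : DependsOn (fun y => ∑ t ∈ Finset.range k, pastDiff ν (f t) (c + t) y)
        (Set.Iic (c + k - 1)) := by
      intro y z h
      refine Finset.sum_congr rfl fun t ht => dependsOn_pastDiff ν _ _ fun i hi => h i ?_
      have h1 := Finset.mem_range.1 ht
      have h2 := Set.mem_Iic.1 hi
      rw [Set.mem_Iic]
      omega
    have h := integral_abs_add_rpow_le hq hn' hS (hD k)
      (integral_rpow_mul_pastDiff_eq_zero hq hSm hS hSdep (hf k) (hfq k))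
    refine h.trans ?_
    set a := 1 + expandConst q / n with ha
    have ha1 : 1 ≤ a := by
      have : 0 ≤ expandConst q / n := by positivity
      linarith
    set b := 2 * expandConst q * (n : ℝ) ^ (q / 2 - 1) with hb
    have hb0 : 0 ≤ b := by positivity
    have e1 := mul_le_mul_of_nonneg_left ih (by linarith : 0 ≤ a)
    have e2 := mul_le_mul_of_nonneg_left (hB k) hb0
    -- The recursion is `E|S_{k+1}|^q ≤ a E|S_k|^q + b B`. Giving the new term the factor `a ^ (k +
    -- 1) ≥ 1` reproduces the closed form `a ^ k * (k * (b * B))`.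
    have e3 : b * B ≤ a ^ (k + 1) * (b * B) :=
      le_mul_of_one_le_left (by positivity) (one_le_pow₀ ha1)
    push_cast
    rw [pow_succ] at e3 ⊢
    nlinarith

/-- After `n` steps the growth factor `(1 + C / n) ^ n` is at most `exp C`, and `n * n ^ (q / 2 - 1)
= n ^ (q / 2)` becomes `√n` on taking the `q`-th root. -/
theorem eLpNorm_sum_pastDiff_le {q : ℝ} (hq : 2 ≤ q) (f : ℕ → (ℤ → E) → ℝ)
    (hf : ∀ k, Measurable (f k))
    (hfq : ∀ k, MemLp (f k) (ENNReal.ofReal q) (Measure.infinitePi ν)) (c : ℤ) (n : ℕ)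
    {Δ : ℝ≥0∞}
    (hΔ : ∀ k, eLpNorm (pastDiff ν (f k) (c + k)) (ENNReal.ofReal q) (Measure.infinitePi ν) ≤ Δ) :
    eLpNorm (fun y => ∑ t ∈ Finset.range n, pastDiff ν (f t) (c + t) y) (ENNReal.ofReal q)
      (Measure.infinitePi ν) ≤ ENNReal.ofReal (momentConst q * √n) * Δ := by
  have hC := one_le_expandConst hq
  have hq0 : 0 < q := by linarith
  rcases Nat.eq_zero_or_pos n with rfl | hn
  · simp
  have hn' : (0 : ℝ) < n := by exact_mod_cast hn
  rcases eq_or_ne Δ ∞ with rfl | hΔt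
  · rw [ENNReal.mul_top]
    · exact le_top
    · have := momentConst_pos hq
      rw [Ne, ENNReal.ofReal_eq_zero, not_le]
      positivity
  have hq1 : 1 ≤ ENNReal.ofReal q := by
    rw [ENNReal.one_le_ofReal]; linarith
  have hD : ∀ t, MemLp (pastDiff ν (f t) (c + t)) (ENNReal.ofReal q) (Measure.infinitePi ν) :=
    fun t => memLp_pastDiff (hf t) hq1 (by simp) (hfq t) _
  have hS : MemLp (fun y => ∑ t ∈ Finset.range n, pastDiff ν (f t) (c + t) y)
      (ENNReal.ofReal q) (Measure.infinitePi ν) :=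
    memLp_finsetSum _ fun t _ => hD t
  set δ := Δ.toReal with hδ
  have hδ0 : 0 ≤ δ := ENNReal.toReal_nonneg
  have hB : ∀ k, ∫ y, |pastDiff ν (f k) (c + k) y| ^ q ∂(Measure.infinitePi ν) ≤ δ ^ q := by
    intro k
    have h := hΔ k
    rw [(hD k).eLpNorm_eq_integral_rpow_norm (by simpa using hq0) (by simp),
      ENNReal.toReal_ofReal hq0.le, ENNReal.ofReal_le_iff_le_toReal hΔt] at h
    simp only [Real.norm_eq_abs] at h
    have h0 : 0 ≤ ∫ y, |pastDiff ν (f k) (c + k) y| ^ q ∂(Measure.infinitePi ν) :=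
      integral_nonneg fun y => by positivity
    have h2 := Real.rpow_le_rpow (by positivity) h hq0.le
    rwa [← Real.rpow_mul h0, inv_mul_cancel₀ hq0.ne', Real.rpow_one] at h2
  have hmain := integral_abs_sum_pastDiff_rpow_le hq f hf hfq c hn hB n
  have hexp : (1 + expandConst q / n) ^ n ≤ Real.exp (expandConst q) := by
    have h1 : 1 + expandConst q / n ≤ Real.exp (expandConst q / n) := by
      rw [add_comm]; exact Real.add_one_le_exp _
    calc (1 + expandConst q / n) ^ n ≤ Real.exp (expandConst q / n) ^ n :=
          pow_le_pow_left₀ (by positivity) h1 n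
      _ = Real.exp (expandConst q) := by
          rw [← Real.exp_nat_mul]; congr 1; field_simp
  have hfin : ∫ y, |∑ t ∈ Finset.range n, pastDiff ν (f t) (c + t) y| ^ q
      ∂(Measure.infinitePi ν) ≤ (momentConst q * √n * δ) ^ q := by
    refine hmain.trans ?_
    have e1 : (momentConst q * √n * δ) ^ q =
        Real.exp (expandConst q) * (2 * expandConst q) * (n : ℝ) ^ (q / 2) * δ ^ q := by
      have hm := (momentConst_pos hq).le
      rw [Real.mul_rpow (by positivity) hδ0, Real.mul_rpow hm (by positivity), momentConst,
        ← Real.rpow_mul (by positivity), one_div_mul_cancel hq0.ne', Real.rpow_one,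
        Real.sqrt_eq_rpow, ← Real.rpow_mul hn'.le]
      congr 3
      ring
    have e2 : (n : ℝ) * (n : ℝ) ^ (q / 2 - 1) = (n : ℝ) ^ (q / 2) := by
      rw [Real.rpow_sub_one hn'.ne']; field_simp
    rw [e1, ← e2]
    calc _ ≤ Real.exp (expandConst q) *
          (n * (2 * expandConst q * (n : ℝ) ^ (q / 2 - 1) * δ ^ q)) :=
          mul_le_mul_of_nonneg_right hexp (by positivity)
      _ = _ := by ring
  rw [hS.eLpNorm_eq_integral_rpow_norm (by simpa using hq0) (by simp),
    ENNReal.toReal_ofReal hq0.le, ← ENNReal.ofReal_toReal hΔt, ← hδ, ← ENNReal.ofReal_mul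
      (by have := momentConst_pos hq; positivity)]
  refine ENNReal.ofReal_le_ofReal ?_
  simp only [Real.norm_eq_abs]
  have h0 : 0 ≤ momentConst q * √n * δ := by
    have := momentConst_pos hq; positivity
  calc _ ≤ ((momentConst q * √n * δ) ^ q) ^ q⁻¹ :=
        Real.rpow_le_rpow (integral_nonneg fun y => by positivity) hfin (by positivity)
    _ = _ := by rw [← Real.rpow_mul h0, mul_inv_cancel₀ hq0.ne', Real.rpow_one]

end Martingale

/-! ### A moment inequality for sums of short range dependent variables -/

section ShortRange

variable {E : Type*} [MeasurableSpace E] {ν : ℤ → Measure E} [∀ i, IsProbabilityMeasure (ν i)]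

theorem self_sub_pastMean_eq_sum {f : (ℤ → E) → ℝ} {s : ℤ} (hf : DependsOn f (Set.Iic s)) (J : ℕ)
    (y : ℤ → E) :
    f y - pastMean ν f (s - J) y = ∑ j ∈ Finset.range J, pastDiff ν f (s - j) y := by
  have h := Finset.sum_range_sub' (fun j : ℕ => pastMean ν f (s - j) y) J
  simp only [Nat.cast_zero, sub_zero, pastMean_eq_self ν hf] at h
  rw [← h]
  refine Finset.sum_congr rfl fun j _ => ?_
  rw [pastDiff, Nat.cast_succ, sub_sub]

/-- The `L^q` norm of a centred sum of `n` functions of the past is of order `√n` times the sum of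
the effects of replacing a single coordinate. -/
theorem eLpNorm_sum_sub_integral_le {q : ℝ} (hq : 2 ≤ q) (f : ℕ → (ℤ → E) → ℝ)
    (hf : ∀ k, Measurable (f k))
    (hfq : ∀ k, MemLp (f k) (ENNReal.ofReal q) (Measure.infinitePi ν)) (c : ℤ)
    (hdep : ∀ k : ℕ, DependsOn (f k) (Set.Iic (c + k))) (Δ : ℕ → ℝ≥0∞)
    (hΔ : ∀ k j : ℕ, eLpNorm (fun w : (ℤ → E) × (ℤ → E) =>
      f k w.1 - f k (Function.update w.1 (c + k - j) (w.2 (c + k - j)))) (ENNReal.ofReal q)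
        ((Measure.infinitePi ν).prod (Measure.infinitePi ν)) ≤ Δ j) (n : ℕ) :
    eLpNorm (fun y => ∑ k ∈ Finset.range n, (f k y - ∫ y', f k y' ∂(Measure.infinitePi ν)))
      (ENNReal.ofReal q) (Measure.infinitePi ν) ≤
        ENNReal.ofReal (momentConst q * √n) * ∑' j, Δ j := by
  set μ := Measure.infinitePi ν with hμ
  have hq1 : 1 ≤ ENNReal.ofReal q := by
    rw [ENNReal.one_le_ofReal]; linarith
  have hfi : ∀ k, Integrable (f k) μ := fun k => (hfq k).integrable hq1
  set G : ℕ → (ℤ → E) → ℝ := fun J y =>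
    ∑ k ∈ Finset.range n, (f k y - pastMean ν (f k) (c + k - J) y) with hG
  set L : (ℤ → E) → ℝ := fun y => ∑ k ∈ Finset.range n, (f k y - ∫ y', f k y' ∂μ) with hL
  have hGm : ∀ J, Measurable (G J) := fun J =>
    Finset.measurable_sum _ fun k _ => (hf k).sub (measurable_pastMean ν (hf k) _)
  have hLm : Measurable L := Finset.measurable_sum _ fun k _ => (hf k).sub_const _
  have hGbound : ∀ J, eLpNorm (G J) (ENNReal.ofReal q) μ ≤
      ENNReal.ofReal (momentConst q * √n) * ∑' j, Δ j := by
    intro J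
    -- Telescoping, then interchanging the sums: for fixed `j` the terms in `k` are martingale
    -- differences at the consecutive times `c - j + k`, so each `j` costs `√n` times `Δ j`.
    have e : G J = ∑ j ∈ Finset.range J, fun y =>
        ∑ k ∈ Finset.range n, pastDiff ν (f k) (c - j + k) y := by
      funext y
      simp only [hG, self_sub_pastMean_eq_sum (hdep _), Finset.sum_apply]
      rw [Finset.sum_comm]
      refine Finset.sum_congr rfl fun j _ => Finset.sum_congr rfl fun k _ => ?_
      rw [show c + (k : ℤ) - j = c - j + k by ring]
    rw [e]
    refine (eLpNorm_sum_le (fun j _ => (Finset.measurable_sum _ fun k _ =>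
      measurable_pastDiff ν (hf k) _).aestronglyMeasurable) hq1).trans ?_
    calc _ ≤ ∑ j ∈ Finset.range J, ENNReal.ofReal (momentConst q * √n) * Δ j := by
          refine Finset.sum_le_sum fun j _ => ?_
          refine eLpNorm_sum_pastDiff_le hq f hf hfq (c - j) n fun k => ?_
          refine (eLpNorm_pastDiff_le (hf k) (hfi k) hq1 (by simp) _).trans ?_
          have := hΔ k j
          rwa [show c + (k : ℤ) - j = c - j + k by ring] at this
      _ = ENNReal.ofReal (momentConst q * √n) * ∑ j ∈ Finset.range J, Δ j := by
          rw [Finset.mul_sum]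
      _ ≤ _ := by gcongr; exact ENNReal.sum_le_tsum _
  have hconv : Tendsto (fun J => eLpNorm (G J - L) 1 μ) atTop (𝓝 0) := by
    have hb : ∀ J, eLpNorm (G J - L) 1 μ ≤ ∑ k ∈ Finset.range n,
        eLpNorm (fun y => pastMean ν (f k) (c + k - J) y - ∫ y', f k y' ∂μ) 1 μ := by
      intro J
      have e : G J - L = -∑ k ∈ Finset.range n,
          fun y => pastMean ν (f k) (c + k - J) y - ∫ y', f k y' ∂μ := by
        funext y
        simp only [hG, hL, Pi.sub_apply, Pi.neg_apply, Finset.sum_apply]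
        rw [← Finset.sum_sub_distrib, ← Finset.sum_neg_distrib]
        exact Finset.sum_congr rfl fun k _ => by ring
      rw [e, eLpNorm_neg]
      exact eLpNorm_sum_le (fun k _ =>
        ((measurable_pastMean ν (hf k) _).sub_const _).aestronglyMeasurable) le_rfl
    have hlim := tendsto_finsetSum (Finset.range n) fun k _ =>
      tendsto_eLpNorm_pastMean (hf k) (hfi k) (c + k)
    simp only [Finset.sum_const_zero] at hlim
    exact tendsto_of_tendsto_of_tendsto_of_le_of_le tendsto_const_nhds hlim
      (fun _ => zero_le) hb
  -- Convergence in `L¹` gives an almost surely convergent subsequence, along which Fatou's lemma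
  -- passes the uniform `L^q` bound to the limit.
  obtain ⟨φ, -, hφ⟩ := (tendstoInMeasure_of_tendsto_eLpNorm one_ne_zero
    (fun J => (hGm J).aestronglyMeasurable) hLm.aestronglyMeasurable hconv).exists_seq_tendsto_ae
  refine (Lp.eLpNorm_lim_le_liminf_eLpNorm (fun J => (hGm (φ J)).aestronglyMeasurable) L hφ).trans ?_
  refine (liminf_le_liminf (Eventually.of_forall fun J => hGbound (φ J))).trans ?_
  simp

end ShortRange

/-! ### Sums of products of short range dependent variables -/

section Products

variable {E : Type*} [MeasurableSpace E]

/-- The function of a two-sided sequence that applies `g` to the past of time `t`. -/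
def ofPast (g : (ℕ → E) → ℝ) (t : ℤ) (y : ℤ → E) : ℝ := g fun k => y (t - k)

theorem measurable_ofPast {g : (ℕ → E) → ℝ} (hg : Measurable g) (t : ℤ) :
    Measurable (ofPast g t) :=
  hg.comp (measurable_pi_lambda _ fun k => measurable_pi_apply (t - (k : ℤ)))

theorem dependsOn_ofPast {E : Type*} (g : (ℕ → E) → ℝ) (t : ℤ) :
    DependsOn (ofPast g t) (Set.Iic t) := by
  intro y z h
  have : (fun k : ℕ => y (t - k)) = fun k : ℕ => z (t - k) :=
    funext fun k => h _ (by rw [Set.mem_Iic]; omega)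
  simp only [ofPast, this]

/-- Write `F G - F' G' = (F - F') G + F' (G - G')` and apply Hölder, which halves the exponent; `F'`
has the same law as `F`. -/
theorem eLpNorm_mul_sub_mul_update_le (ν : ℤ → Measure E) [∀ i, IsProbabilityMeasure (ν i)]
    {m : ℝ} (hm : 0 < m) {F G : (ℤ → E) → ℝ} (hF : Measurable F) (hG : Measurable G)
    (s : ℤ) (h1 : 1 ≤ ENNReal.ofReal (m / 2)) :
    eLpNorm (fun w : (ℤ → E) × (ℤ → E) => F w.1 * G w.1
      - F (Function.update w.1 s (w.2 s)) * G (Function.update w.1 s (w.2 s)))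
      (ENNReal.ofReal (m / 2)) ((Measure.infinitePi ν).prod (Measure.infinitePi ν)) ≤
    eLpNorm (fun w : (ℤ → E) × (ℤ → E) => F w.1 - F (Function.update w.1 s (w.2 s)))
        (ENNReal.ofReal m) ((Measure.infinitePi ν).prod (Measure.infinitePi ν))
      * eLpNorm G (ENNReal.ofReal m) (Measure.infinitePi ν) +
    eLpNorm F (ENNReal.ofReal m) (Measure.infinitePi ν)
      * eLpNorm (fun w : (ℤ → E) × (ℤ → E) => G w.1 - G (Function.update w.1 s (w.2 s)))
        (ENNReal.ofReal m) ((Measure.infinitePi ν).prod (Measure.infinitePi ν)) := by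
  set μ := Measure.infinitePi ν
  have : (ENNReal.ofReal m).HolderTriple (ENNReal.ofReal m) (ENNReal.ofReal (m / 2)) := by
    constructor
    rw [← ENNReal.ofReal_inv_of_pos hm, ← ENNReal.ofReal_inv_of_pos (by positivity),
      ← ENNReal.ofReal_add (by positivity) (by positivity)]
    congr 1
    field_simp
    norm_num
  have mU := measurable_update_snd (E := E) s
  have mF1 : Measurable fun w : (ℤ → E) × (ℤ → E) => F w.1 := hF.comp measurable_fst
  have mG1 : Measurable fun w : (ℤ → E) × (ℤ → E) => G w.1 := hG.comp measurable_fst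
  have mF2 : Measurable fun w : (ℤ → E) × (ℤ → E) => F (Function.update w.1 s (w.2 s)) :=
    hF.comp mU
  have mG2 : Measurable fun w : (ℤ → E) × (ℤ → E) => G (Function.update w.1 s (w.2 s)) :=
    hG.comp mU
  have e : (fun w : (ℤ → E) × (ℤ → E) => F w.1 * G w.1
      - F (Function.update w.1 s (w.2 s)) * G (Function.update w.1 s (w.2 s))) =
      (fun w : (ℤ → E) × (ℤ → E) => F w.1 - F (Function.update w.1 s (w.2 s))) •
        (fun w : (ℤ → E) × (ℤ → E) => G w.1)
      + (fun w : (ℤ → E) × (ℤ → E) => F (Function.update w.1 s (w.2 s))) •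
        (fun w : (ℤ → E) × (ℤ → E) => G w.1 - G (Function.update w.1 s (w.2 s))) := by
    funext w
    simp only [Pi.add_apply, smul_eq_mul, Pi.mul_apply]
    ring
  rw [e]
  refine (eLpNorm_add_le ((mF1.sub mF2).smul mG1).aestronglyMeasurable
    (mF2.smul (mG1.sub mG2)).aestronglyMeasurable h1).trans (add_le_add ?_ ?_)
  · refine (eLpNorm_smul_le_mul_eLpNorm (p := ENNReal.ofReal m) (q := ENNReal.ofReal m)
      mG1.aestronglyMeasurable (mF1.sub mF2).aestronglyMeasurable).trans (le_of_eq ?_)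
    congr 1
    exact eLpNorm_comp_measurePreserving (f := Prod.fst) hG.aestronglyMeasurable
      (measurePreserving_fst (μ := μ) (ν := μ))
  · refine (eLpNorm_smul_le_mul_eLpNorm (p := ENNReal.ofReal m) (q := ENNReal.ofReal m)
      (mG1.sub mG2).aestronglyMeasurable mF2.aestronglyMeasurable).trans (le_of_eq ?_)
    congr 1
    exact eLpNorm_comp_measurePreserving hF.aestronglyMeasurable
      (measurePreserving_update_snd ν s)

variable {Ω : Type*} [MeasurableSpace Ω] {P : Measure Ω}

theorem measurePreserving_path {e : ℤ → Ω → E} (he_meas : ∀ t, Measurable (e t))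
    (he_indep : iIndepFun e P) :
    MeasurePreserving (fun ω t => e t ω) P (Measure.infinitePi fun t => P.map (e t)) :=
  ⟨measurable_pi_lambda _ he_meas, he_indep.map_fun_eq_infinitePi_map he_meas⟩

variable [IsProbabilityMeasure P]

/-- Seen from time `c - a`, the coordinate `c - j` lies at lag `j - a`. For `j < a` it is in the
future and replacing it has no effect. -/
theorem eLpNorm_ofPast_sub_update_le {e : ℤ → Ω → E} (he_meas : ∀ t, Measurable (e t))
    (he_indep : iIndepFun e P) [∀ t, IsProbabilityMeasure (P.map (e t))] (m : ℝ) {d : ℕ}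
    {g : ℤ → Fin d → (ℕ → E) → ℝ}
    (hg : ∀ t i, Measurable (g t i)) (c : ℤ) (a j : ℕ) (i : Fin d) :
    eLpNorm (fun w : (ℤ → E) × (ℤ → E) => ofPast (g (c - a) i) (c - a) w.1
      - ofPast (g (c - a) i) (c - a) (Function.update w.1 (c - j) (w.2 (c - j))))
      (ENNReal.ofReal m) ((Measure.infinitePi fun t => P.map (e t)).prod
        (Measure.infinitePi fun t => P.map (e t)))
      ≤ if a ≤ j then dependenceCoeff P e m g (j - a) else 0 := by
  set t : ℤ := c - a with ht
  split_ifs with haj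
  · have hmp := measurePreserving_path he_meas he_indep
    have hF : Measurable fun w : (ℤ → E) × (ℤ → E) => ofPast (g t i) t w.1
        - ofPast (g t i) t (Function.update w.1 (c - j) (w.2 (c - j))) :=
      ((measurable_ofPast (hg t i) t).comp measurable_fst).sub
        ((measurable_ofPast (hg t i) t).comp (measurable_update_snd _))
    rw [← eLpNorm_comp_measurePreserving hF.aestronglyMeasurable (hmp.prod hmp)]
    refine le_trans (le_of_eq ?_) (le_iSup₂ (f := fun (t : ℤ) (i : Fin d) =>
      eLpNorm (fun w : Ω × Ω => g t i (fun k => e (t - k) w.1)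
      - g t i (Function.update (fun k : ℕ => e (t - k) w.1) (j - a)
        (e (t - (j - a : ℕ)) w.2))) (ENNReal.ofReal m) (P.prod P)) t i)
    congr 1
    funext w
    simp only [Function.comp_apply, ofPast]
    congr 2
    funext k
    have hs : c - (j : ℤ) = t - (j - a : ℕ) := by rw [ht]; omega
    by_cases hk : k = j - a
    · subst hk
      rw [Function.update_self, hs, Function.update_self]
      rfl
    · rw [Function.update_of_ne hk, Function.update_of_ne]
      · rfl
      · rw [hs]
        omega
  · have : (fun w : (ℤ → E) × (ℤ → E) => ofPast (g t i) t w.1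
        - ofPast (g t i) t (Function.update w.1 (c - j) (w.2 (c - j)))) = fun _ => 0 := by
      funext w
      rw [sub_eq_zero]
      refine dependsOn_ofPast _ _ fun r hr => ?_
      rw [Function.update_of_ne]
      have := Set.mem_Iic.1 hr
      omega
    rw [this]
    simp

theorem tsum_shift_le (δ : ℕ → ℝ≥0∞) (a : ℕ) :
    ∑' j, (if a ≤ j then δ (j - a) else 0) ≤ ∑' j, δ j := by
  rw [← ENNReal.summable.sum_add_tsum_nat_add' (k := a)]
  have h1 : ∑ j ∈ Finset.range a, (if a ≤ j then δ (j - a) else 0) = 0 :=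
    Finset.sum_eq_zero fun j hj => by
      have := Finset.mem_range.1 hj
      rw [if_neg (by omega)]
  rw [h1, zero_add]
  exact le_of_eq (tsum_congr fun j => by simp)

theorem eLpNorm_sum_mul_sub_integral_le {e : ℤ → Ω → E} (he_meas : ∀ t, Measurable (e t))
    (he_indep : iIndepFun e P) {m : ℝ} (hm : 4 ≤ m) {d : ℕ} {x : ℤ → Ω → Fin d → ℝ}
    {g : ℤ → Fin d → (ℕ → E) → ℝ} (hg : ∀ t i, Measurable (g t i))
    (hx : ∀ t i, ∀ᵐ ω ∂P, x t ω i = g t i (fun k => e (t - k) ω)) {C₁ C₂ : ℝ}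
    (hC₁ : ∀ t i, eLpNorm (fun ω => x t ω i) (ENNReal.ofReal m) P ≤ ENNReal.ofReal C₁)
    (hC₂ : ∑' j, dependenceCoeff P e m g j ≤ ENNReal.ofReal C₂)
    (c : ℤ) (a b : ℕ) (i₁ i₂ : Fin d) (n : ℕ) :
    eLpNorm (fun ω => ∑ k ∈ Finset.range n, (x (c + k - a) ω i₁ * x (c + k - b) ω i₂
      - ∫ ω', x (c + k - a) ω' i₁ * x (c + k - b) ω' i₂ ∂P)) (ENNReal.ofReal (m / 2)) P ≤
      ENNReal.ofReal (momentConst (m / 2) * √n)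
        * (2 * (ENNReal.ofReal C₁ * ENNReal.ofReal C₂)) := by
  have hprob : ∀ t, IsProbabilityMeasure (P.map (e t)) := fun t =>
    Measure.isProbabilityMeasure_map (he_meas t).aemeasurable
  set ν : ℤ → Measure E := fun t => P.map (e t) with hν
  set μ := Measure.infinitePi ν with hμ
  have hmp : MeasurePreserving (fun ω t => e t ω) P μ := measurePreserving_path he_meas he_indep
  have h1 : 1 ≤ ENNReal.ofReal (m / 2) := by rw [ENNReal.one_le_ofReal]; linarith
  have hGm : ∀ t i, Measurable (ofPast (g t i) t) := fun t i => measurable_ofPast (hg t i) t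
  have hGx : ∀ t i, (fun ω => x t ω i) =ᵐ[P] (ofPast (g t i) t) ∘ fun ω t => e t ω := hx
  have hGn : ∀ t i, eLpNorm (ofPast (g t i) t) (ENNReal.ofReal m) μ ≤ ENNReal.ofReal C₁ := by
    intro t i
    rw [← eLpNorm_comp_measurePreserving (hGm t i).aestronglyMeasurable hmp,
      ← eLpNorm_congr_ae (hGx t i)]
    exact hC₁ t i
  set f : ℕ → (ℤ → E) → ℝ := fun k y => ofPast (g (c + k - a) i₁) (c + k - a) y
    * ofPast (g (c + k - b) i₂) (c + k - b) y with hf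
  have hfm : ∀ k, Measurable (f k) := fun k => (hGm _ _).mul (hGm _ _)
  have htriple : (ENNReal.ofReal m).HolderTriple (ENNReal.ofReal m) (ENNReal.ofReal (m / 2)) := by
    constructor
    rw [← ENNReal.ofReal_inv_of_pos (by linarith), ← ENNReal.ofReal_inv_of_pos (by linarith),
      ← ENNReal.ofReal_add (by positivity) (by positivity)]
    congr 1
    field_simp
    norm_num
  have hfq : ∀ k, MemLp (f k) (ENNReal.ofReal (m / 2)) μ := by
    intro k
    have A : MemLp (ofPast (g (c + k - a) i₁) (c + k - a)) (ENNReal.ofReal m) μ :=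
      ⟨(hGm _ _).aestronglyMeasurable, (hGn _ _).trans_lt ENNReal.ofReal_lt_top⟩
    have B : MemLp (ofPast (g (c + k - b) i₂) (c + k - b)) (ENNReal.ofReal m) μ :=
      ⟨(hGm _ _).aestronglyMeasurable, (hGn _ _).trans_lt ENNReal.ofReal_lt_top⟩
    exact B.mul A
  have hdep : ∀ k : ℕ, DependsOn (f k) (Set.Iic (c + k)) := by
    intro k y z h
    have e1 : ∀ (u : ℕ) (G : (ℕ → E) → ℝ), ofPast G (c + k - u) y = ofPast G (c + k - u) z :=
      fun u G => dependsOn_ofPast _ _ fun r hr => h r (by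
        rw [Set.mem_Iic] at hr ⊢; omega)
    simp only [hf, e1]
  set δ := dependenceCoeff P e m g with hδ
  -- One term per factor of the product. Shifting by `a` or `b` does not enlarge the total, so the
  -- bound `2 C₁ C₂` is free of the lags.
  set Δ : ℕ → ℝ≥0∞ := fun j => ENNReal.ofReal C₁ * (if a ≤ j then δ (j - a) else 0)
    + ENNReal.ofReal C₁ * (if b ≤ j then δ (j - b) else 0) with hΔ
  have hΔb : ∀ k j : ℕ, eLpNorm (fun w : (ℤ → E) × (ℤ → E) =>
      f k w.1 - f k (Function.update w.1 (c + k - j) (w.2 (c + k - j)))) (ENNReal.ofReal (m / 2))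
        (μ.prod μ) ≤ Δ j := by
    intro k j
    refine (eLpNorm_mul_sub_mul_update_le ν (by linarith : 0 < m) (hGm _ _) (hGm _ _)
      (c + k - j) h1).trans (add_le_add ?_ ?_)
    · rw [mul_comm]
      exact mul_le_mul' (hGn _ _)
        (eLpNorm_ofPast_sub_update_le he_meas he_indep m hg (c + k) a j i₁)
    · exact mul_le_mul' (hGn _ _)
        (eLpNorm_ofPast_sub_update_le he_meas he_indep m hg (c + k) b j i₂)
  have hmain := eLpNorm_sum_sub_integral_le (by linarith : 2 ≤ m / 2) f hfm hfq c hdep Δ hΔb n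
  have hsum : ∑' j, Δ j ≤ 2 * (ENNReal.ofReal C₁ * ENNReal.ofReal C₂) := by
    rw [ENNReal.tsum_add, ENNReal.tsum_mul_left, ENNReal.tsum_mul_left, two_mul]
    gcongr
    · exact (tsum_shift_le δ a).trans hC₂
    · exact (tsum_shift_le δ b).trans hC₂
  refine le_trans (le_of_eq ?_) (hmain.trans (mul_le_mul' le_rfl hsum))
  have hLm : Measurable fun y => ∑ k ∈ Finset.range n, (f k y - ∫ y', f k y' ∂μ) :=
    Finset.measurable_sum _ fun k _ => (hfm k).sub_const _
  rw [← eLpNorm_comp_measurePreserving hLm.aestronglyMeasurable hmp]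
  refine eLpNorm_congr_ae ?_
  have hint : ∀ k, ∫ ω', x (c + (k : ℕ) - a) ω' i₁ * x (c + k - b) ω' i₂ ∂P
      = ∫ y', f k y' ∂μ := by
    intro k
    rw [← hmp.map_eq, integral_map hmp.measurable.aemeasurable (hfm k).aestronglyMeasurable]
    refine integral_congr_ae ?_
    filter_upwards [hGx (c + k - a) i₁, hGx (c + k - b) i₂] with ω h1 h2
    rw [h1, h2]
    rfl
  have hall : ∀ᵐ ω ∂P, ∀ t i, x t ω i = ofPast (g t i) t fun t => e t ω :=
    ae_all_iff.2 fun t => ae_all_iff.2 fun i => hGx t i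
  filter_upwards [hall] with ω hω
  simp only [hint, hω, hf, Function.comp_apply]

end Products

/-! ### Powers of a stable matrix -/

open scoped Matrix.Norms.Operator in
-- By Gelfand's formula the norms of the complex powers are eventually below `r ^ k`, for some `r <
-- 1` above the spectral radius.
theorem tendsto_pow_entry_zero {n : Type*} [Fintype n] [DecidableEq n] (M : Matrix n n ℝ)
    (hM : ∀ μ ∈ spectrum ℂ (M.map (algebraMap ℝ ℂ)), ‖μ‖ < 1) (a b : n) :
    Tendsto (fun k : ℕ => (M ^ k) a b) atTop (𝓝 0) := by
  have : Nonempty n := ⟨a⟩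
  set A : Matrix n n ℂ := M.map (algebraMap ℝ ℂ) with hA
  have hrad : spectralRadius ℂ A < ((1 : NNReal) : ℝ≥0∞) :=
    spectrum.spectralRadius_lt_of_forall_lt A fun z hz => by
      have := hM z hz
      exact_mod_cast this
  obtain ⟨r, hr1, hr2⟩ := ENNReal.lt_iff_exists_nnreal_btwn.1 hrad
  have hgel := spectrum.pow_nnnorm_pow_one_div_tendsto_nhds_spectralRadius A
  have hev := (hgel.eventually (gt_mem_nhds hr1)).and (eventually_ge_atTop 1)
  have hentry : ∀ (B : Matrix n n ℂ) (i j : n), ‖B i j‖ ≤ ‖B‖ := by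
    intro B i j
    have h1 : ‖B i j‖₊ ≤ ‖B‖₊ := by
      rw [Matrix.linfty_opNNNorm_def]
      refine le_trans ?_ (Finset.le_sup (f := fun i => ∑ j, ‖B i j‖₊) (Finset.mem_univ i))
      exact Finset.single_le_sum (f := fun j => ‖B i j‖₊) (fun _ _ => zero_le)
        (Finset.mem_univ j)
    exact_mod_cast h1
  have hbound : ∀ᶠ k : ℕ in atTop, ‖(M ^ k) a b‖ ≤ (r : ℝ) ^ k := by
    filter_upwards [hev] with k hk
    have hk0 : (0 : ℝ) < k := by exact_mod_cast hk.2
    have h1 : (‖A ^ k‖₊ : ℝ≥0∞) ≤ (r : ℝ≥0∞) ^ k := by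
      have h2 := ENNReal.rpow_le_rpow hk.1.le hk0.le
      rwa [← ENNReal.rpow_mul, one_div_mul_cancel hk0.ne', ENNReal.rpow_one,
        ENNReal.rpow_natCast] at h2
    have h3 : ‖A ^ k‖ ≤ (r : ℝ) ^ k := by exact_mod_cast h1
    have h4 : (A ^ k) a b = (((M ^ k) a b : ℝ) : ℂ) := by
      have : A ^ k = (M ^ k).map (algebraMap ℝ ℂ) := by
        rw [hA, Matrix.map_pow]
      rw [this]; rfl
    have h5 := (hentry (A ^ k) a b).trans h3
    rwa [h4, Complex.norm_real] at h5
  have hr : (r : ℝ) < 1 := by exact_mod_cast hr2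
  exact squeeze_zero_norm' hbound (tendsto_pow_atTop_nhds_zero_of_lt_one r.2 hr)

/-- Unrolling gives `v 0 = (M ^ k)ᵀ v k`, a null sequence of matrices applied to bounded vectors.
Applied to moments, with `k` counting steps into the past. -/
theorem eq_zero_of_bounded_recursion {n : Type*} [Fintype n] [DecidableEq n] (M : Matrix n n ℝ)
    (hM : ∀ μ ∈ spectrum ℂ (M.map (algebraMap ℝ ℂ)), ‖μ‖ < 1) (v : ℕ → n → ℝ) {C : ℝ}
    (hC : ∀ k a, |v k a| ≤ C) (hv : ∀ k, v k = Mᵀ *ᵥ v (k + 1)) : v 0 = 0 := by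
  have hiter : ∀ k, v 0 = (M ^ k)ᵀ *ᵥ v k := by
    intro k
    induction k with
    | zero => simp
    | succ k ih =>
      rw [ih, hv k, Matrix.mulVec_mulVec, ← Matrix.transpose_mul, pow_succ']
  funext a
  have hlim : Tendsto (fun k => ∑ b, |(M ^ k) b a| * C) atTop (𝓝 0) := by
    have : Tendsto (fun k => ∑ b, |(M ^ k) b a| * C) atTop (𝓝 (∑ _b : n, |(0 : ℝ)| * C)) :=
      tendsto_finsetSum _ fun b _ => ((tendsto_pow_entry_zero M hM b a).abs).mul_const C
    simpa using this
  refine abs_eq_zero.1 (le_antisymm (ge_of_tendsto' hlim fun k => ?_) (abs_nonneg _))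
  rw [hiter k, Matrix.mulVec, dotProduct]
  refine (Finset.abs_sum_le_sum_abs _ _).trans (Finset.sum_le_sum fun b _ => ?_)
  rw [abs_mul, Matrix.transpose_apply]
  exact mul_le_mul_of_nonneg_left (hC k b) (abs_nonneg _)

theorem eq_zero_of_bounded_conj_recursion {n : Type*} [Fintype n] [DecidableEq n]
    (M : Matrix n n ℝ) (hM : ∀ μ ∈ spectrum ℂ (M.map (algebraMap ℝ ℂ)), ‖μ‖ < 1)
    (D : ℕ → Matrix n n ℝ) {C : ℝ} (hC : ∀ k a b, |D k a b| ≤ C)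
    (hD : ∀ k, D k = Mᵀ * D (k + 1) * M) : D 0 = 0 := by
  have hiter : ∀ k, D 0 = (M ^ k)ᵀ * D k * M ^ k := by
    intro k
    induction k with
    | zero => simp
    | succ k ih =>
      rw [ih, hD k, pow_succ', Matrix.transpose_mul]
      simp only [Matrix.mul_assoc]
  ext a b
  have hlim : Tendsto (fun k => ∑ j, (∑ i, |(M ^ k) i a| * C) * |(M ^ k) j b|) atTop (𝓝 0) := by
    have : Tendsto (fun k => ∑ j, (∑ i, |(M ^ k) i a| * C) * |(M ^ k) j b|) atTop
        (𝓝 (∑ _j : n, (∑ _i : n, |(0 : ℝ)| * C) * |(0 : ℝ)|)) :=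
      tendsto_finsetSum _ fun j _ => (tendsto_finsetSum _ fun i _ =>
        ((tendsto_pow_entry_zero M hM i a).abs).mul_const C).mul
          (tendsto_pow_entry_zero M hM j b).abs
    simpa using this
  refine abs_eq_zero.1 (le_antisymm (ge_of_tendsto' hlim fun k => ?_) (abs_nonneg _))
  rw [hiter k, Matrix.mul_apply]
  refine (Finset.abs_sum_le_sum_abs _ _).trans (Finset.sum_le_sum fun j _ => ?_)
  rw [abs_mul, Matrix.mul_apply]
  refine mul_le_mul_of_nonneg_right ?_ (abs_nonneg _)
  refine (Finset.abs_sum_le_sum_abs _ _).trans (Finset.sum_le_sum fun i _ => ?_)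
  rw [abs_mul, Matrix.transpose_apply]
  exact mul_le_mul_of_nonneg_left (hC k i j) (abs_nonneg _)

/-! ### Second moments of a stable vector autoregression -/

section Moments

variable {Ω : Type*} [MeasurableSpace Ω] {P : Measure Ω}

theorem integrable_mul_of_memLp {f g : Ω → ℝ} (hf : MemLp f 2 P) (hg : MemLp g 2 P) :
    Integrable (fun ω => f ω * g ω) P := hf.integrable_mul hg

theorem integral_sum_mul {ι : Type*} (s : Finset ι) (r : ι → ℝ) {f : ι → Ω → ℝ} {g : Ω → ℝ}
    (hf : ∀ i, MemLp (f i) 2 P) (hg : MemLp g 2 P) :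
    ∫ ω, (∑ i ∈ s, r i * f i ω) * g ω ∂P = ∑ i ∈ s, r i * ∫ ω, f i ω * g ω ∂P := by
  simp only [Finset.sum_mul, mul_assoc]
  rw [integral_finsetSum _ fun i _ => (integrable_mul_of_memLp (hf i) hg).const_mul (r i)]
  simp only [integral_const_mul]

theorem integral_add_mul' {f₁ f₂ g : Ω → ℝ} (h₁ : MemLp f₁ 2 P) (h₂ : MemLp f₂ 2 P)
    (hg : MemLp g 2 P) :
    ∫ ω, (f₁ ω + f₂ ω) * g ω ∂P = ∫ ω, f₁ ω * g ω ∂P + ∫ ω, f₂ ω * g ω ∂P := by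
  simp only [add_mul]
  exact integral_add (integrable_mul_of_memLp h₁ hg) (integrable_mul_of_memLp h₂ hg)

theorem abs_integral_mul_le {f g : Ω → ℝ} (hf : MemLp f 2 P) (hg : MemLp g 2 P) :
    |∫ ω, f ω * g ω ∂P| ≤ ∫ ω, f ω ^ 2 ∂P + ∫ ω, g ω ^ 2 ∂P := by
  rw [← integral_add hf.integrable_sq hg.integrable_sq]
  refine (abs_integral_le_integral_abs).trans
    (integral_mono (integrable_mul_of_memLp hf hg).abs (hf.integrable_sq.add hg.integrable_sq)
      fun ω => ?_)
  rw [abs_le]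
  constructor <;> nlinarith [sq_nonneg (f ω + g ω), sq_nonneg (f ω - g ω)]

variable {d p : ℕ} {A : Fin p → Matrix (Fin d) (Fin d) ℝ} {x eps : ℤ → Ω → Fin d → ℝ}

/-- The innovation of the stacked process `z`. -/
def stackedNoise (p : ℕ) (eps : ℤ → Ω → Fin d → ℝ) (t : ℤ) (ω : Ω) (b : Fin p × Fin d) : ℝ :=
  if (b.1 : ℕ) = 0 then eps t ω b.2 else 0

theorem response_eq
    (hAR : ∀ t : ℤ, ∀ᵐ ω ∂P, x t ω = (∑ j : Fin p, A j *ᵥ x (t - ((j : ℕ) + 1)) ω) + eps t ω) :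
    ∀ᵐ ω ∂P, ∀ (t : ℤ) (l : Fin d), x t ω l =
      (∑ a, paramMatrix A a l * lagVector p (fun t => x t ω) (t - 1) a) + eps t ω l := by
  filter_upwards [ae_all_iff.2 hAR] with ω hω t l
  have h := congrFun (hω t) l
  rw [h, Pi.add_apply, Finset.sum_apply, Fintype.sum_prod_type]
  congr 1
  refine Finset.sum_congr rfl fun j _ => ?_
  rw [Matrix.mulVec, dotProduct]
  refine Finset.sum_congr rfl fun k _ => ?_
  simp only [paramMatrix, lagVector, Matrix.of_apply]
  rw [show t - ((j : ℕ) + 1 : ℤ) = t - 1 - (j : ℕ) by ring]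

theorem lagVector_eq
    (hAR : ∀ t : ℤ, ∀ᵐ ω ∂P, x t ω = (∑ j : Fin p, A j *ᵥ x (t - ((j : ℕ) + 1)) ω) + eps t ω) :
    ∀ᵐ ω ∂P, ∀ (t : ℤ) (b : Fin p × Fin d), lagVector p (fun t => x t ω) t b =
      (∑ a, companion (paramMatrix A) a b * lagVector p (fun t => x t ω) (t - 1) a)
        + stackedNoise p eps t ω b := by
  filter_upwards [response_eq hAR] with ω hω t b
  by_cases hb : (b.1 : ℕ) = 0
  · simp only [companion, stackedNoise, hb, if_true, Matrix.of_apply]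
    rw [← hω t b.2]
    simp [lagVector, hb]
  · simp only [companion, stackedNoise, hb, if_false, Matrix.of_apply, add_zero]
    have hlt := b.1.2
    rw [Finset.sum_eq_single ((⟨(b.1 : ℕ) - 1, by omega⟩ : Fin p), b.2)]
    · rw [if_pos ⟨by simp only; omega, rfl⟩, one_mul]
      simp only [lagVector]
      rw [show t - 1 - (((b.1 : ℕ) - 1 : ℕ) : ℤ) = t - ((b.1 : ℕ) : ℤ) by omega]
    · intro a _ ha
      rw [if_neg, zero_mul]
      rintro ⟨h1, h2⟩
      refine ha (Prod.ext (Fin.ext ?_) h2)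
      simp only
      omega
    · simp

theorem memLp_stackedNoise (hnoise : IsWhiteNoise P eps) (t : ℤ) (b : Fin p × Fin d) :
    MemLp (fun ω => stackedNoise p eps t ω b) 2 P := by
  by_cases hb : (b.1 : ℕ) = 0
  · simpa only [stackedNoise, hb, if_true] using hnoise.memLp t b.2
  · simp only [stackedNoise, hb, if_false]
    exact MemLp.zero'

theorem memLp_lagVector (hx2 : ∀ t i, MemLp (fun ω => x t ω i) 2 P) (t : ℤ) (b : Fin p × Fin d) :
    MemLp (fun ω => lagVector p (fun t => x t ω) t b) 2 P := hx2 _ _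

/-- Future innovations are uncorrelated with the process. -/
theorem integral_lagVector_mul_noise
    (hAR : ∀ t : ℤ, ∀ᵐ ω ∂P, x t ω = (∑ j : Fin p, A j *ᵥ x (t - ((j : ℕ) + 1)) ω) + eps t ω)
    (hnoise : IsWhiteNoise P eps) (hx2 : ∀ t i, MemLp (fun ω => x t ω i) 2 P) {C : ℝ}
    (hC : ∀ t i, ∫ ω, x t ω i ^ 2 ∂P ≤ C)
    (hstable : ∀ μ ∈ spectrum ℂ ((companion (paramMatrix A)).map (algebraMap ℝ ℂ)), ‖μ‖ < 1)
    {t s : ℤ} (hts : t < s) (a : Fin p × Fin d) (l : Fin d) :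
    ∫ ω, lagVector p (fun t => x t ω) t a * eps s ω l ∂P = 0 := by
  -- Going back from `t`, the recursion only brings in innovations at times at most `t < s`,
  -- uncorrelated with the one at `s`; hence it is homogeneous.
  set v : ℕ → Fin p × Fin d → ℝ := fun k b =>
    ∫ ω, lagVector p (fun t => x t ω) (t - k) b * eps s ω l ∂P with hv
  have hrec : ∀ k, v k = (companion (paramMatrix A))ᵀ *ᵥ v (k + 1) := by
    intro k
    funext b
    have h1 : v k b = ∫ ω, ((∑ a, companion (paramMatrix A) a b
        * lagVector p (fun t => x t ω) (t - k - 1) a) + stackedNoise p eps (t - k) ω b)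
        * eps s ω l ∂P := by
      refine integral_congr_ae ?_
      filter_upwards [lagVector_eq hAR] with ω hω
      rw [hω (t - k) b]
    rw [h1, integral_add_mul' (memLp_finsetSum _ fun a _ => (memLp_lagVector hx2 _ a).const_mul _)
      (memLp_stackedNoise hnoise _ b) (hnoise.memLp s l),
      integral_sum_mul _ _ (fun a => memLp_lagVector hx2 _ a) (hnoise.memLp s l)]
    have h2 : ∫ ω, stackedNoise p eps (t - k) ω b * eps s ω l ∂P = 0 := by
      by_cases hb : (b.1 : ℕ) = 0
      · obtain ⟨Sig, hSig⟩ := hnoise.cov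
        simp only [stackedNoise, hb, if_true]
        rw [hSig, if_neg (by omega)]
      · simp [stackedNoise, hb]
    rw [h2, add_zero, Matrix.mulVec, dotProduct]
    refine Finset.sum_congr rfl fun a _ => ?_
    simp only [hv, Matrix.transpose_apply]
    rw [show t - (k : ℤ) - 1 = t - ((k + 1 : ℕ) : ℤ) by push_cast; ring]
  have hbd : ∀ k b, |v k b| ≤ C + ∫ ω, eps s ω l ^ 2 ∂P := fun k b =>
    (abs_integral_mul_le (memLp_lagVector hx2 _ b) (hnoise.memLp s l)).trans
      (by gcongr; exact hC _ _)
  have h0 := congrFun (eq_zero_of_bounded_recursion _ hstable v hbd hrec) a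
  simpa [hv] using h0

/-- The covariance matrix of the stacked process does not depend on time. -/
theorem integral_lagVector_mul_lagVector
    (hAR : ∀ t : ℤ, ∀ᵐ ω ∂P, x t ω = (∑ j : Fin p, A j *ᵥ x (t - ((j : ℕ) + 1)) ω) + eps t ω)
    (hnoise : IsWhiteNoise P eps) (hx2 : ∀ t i, MemLp (fun ω => x t ω i) 2 P) {C : ℝ}
    (hC : ∀ t i, ∫ ω, x t ω i ^ 2 ∂P ≤ C)
    (hstable : ∀ μ ∈ spectrum ℂ ((companion (paramMatrix A)).map (algebraMap ℝ ℂ)), ‖μ‖ < 1)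
    (t : ℤ) (a b : Fin p × Fin d) :
    ∫ ω, lagVector p (fun t => x t ω) t a * lagVector p (fun t => x t ω) t b ∂P
      = sigmaZero P p x a b := by
  set M := companion (paramMatrix A) with hM
  set Γ : ℤ → Matrix (Fin p × Fin d) (Fin p × Fin d) ℝ := fun t => Matrix.of fun a b =>
    ∫ ω, lagVector p (fun t => x t ω) t a * lagVector p (fun t => x t ω) t b ∂P with hΓ
  obtain ⟨Sig, hSig⟩ := hnoise.cov
  set Q : Matrix (Fin p × Fin d) (Fin p × Fin d) ℝ := Matrix.of fun a b =>
    ∫ ω, stackedNoise p eps 0 ω a * stackedNoise p eps 0 ω b ∂P with hQ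
  have hQt : ∀ t a b, ∫ ω, stackedNoise p eps t ω a * stackedNoise p eps t ω b ∂P = Q a b := by
    intro t a b
    simp only [hQ, Matrix.of_apply]
    by_cases ha : (a.1 : ℕ) = 0
    · by_cases hb : (b.1 : ℕ) = 0
      · simp only [stackedNoise, ha, hb, if_true, hSig]
      · simp [stackedNoise, hb]
    · simp [stackedNoise, ha]
  have hcross : ∀ t a b,
      ∫ ω, lagVector p (fun t => x t ω) (t - 1) a * stackedNoise p eps t ω b ∂P = 0 := by
    intro t a b
    by_cases hb : (b.1 : ℕ) = 0
    · simp only [stackedNoise, hb, if_true]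
      exact integral_lagVector_mul_noise hAR hnoise hx2 hC hstable (by omega) a b.2
    · simp [stackedNoise, hb]
  have hz := memLp_lagVector (p := p) hx2
  have hu := memLp_stackedNoise (p := p) hnoise
  have hlin : ∀ t b, MemLp (fun ω => ∑ c, M c b * lagVector p (fun t => x t ω) (t - 1) c) 2 P :=
    fun t b => memLp_finsetSum _ fun c _ => (hz _ c).const_mul _
  have hrec : ∀ t, Γ t = Mᵀ * Γ (t - 1) * M + Q := by
    intro t
    ext a b
    have h1 : Γ t a b = ∫ ω, ((∑ c, M c a * lagVector p (fun t => x t ω) (t - 1) c)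
        + stackedNoise p eps t ω a) * ((∑ c, M c b * lagVector p (fun t => x t ω) (t - 1) c)
        + stackedNoise p eps t ω b) ∂P := by
      refine integral_congr_ae ?_
      filter_upwards [lagVector_eq hAR] with ω hω
      rw [hω t a, hω t b]
    have h2 : ∀ c, ∫ ω, lagVector p (fun t => x t ω) (t - 1) c *
        ((∑ c, M c b * lagVector p (fun t => x t ω) (t - 1) c) + stackedNoise p eps t ω b) ∂P
        = ∑ c', M c' b * Γ (t - 1) c c' := by
      intro c
      simp only [mul_comm (lagVector p _ (t - 1) c)]
      rw [integral_add_mul' (hlin t b) (hu t b) (hz _ c), integral_sum_mul _ _ (hz _) (hz _ c)]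
      simp only [mul_comm (stackedNoise p eps t _ b), hcross, add_zero]
      refine Finset.sum_congr rfl fun c' _ => ?_
      simp only [hΓ, Matrix.of_apply, mul_comm]
    have h3 : ∫ ω, stackedNoise p eps t ω a *
        ((∑ c, M c b * lagVector p (fun t => x t ω) (t - 1) c) + stackedNoise p eps t ω b) ∂P
        = Q a b := by
      simp only [mul_comm (stackedNoise p eps t _ a)]
      rw [integral_add_mul' (hlin t b) (hu t b) (hu t a), integral_sum_mul _ _ (hz _) (hu t a)]
      simp only [hcross, mul_zero, Finset.sum_const_zero, zero_add]
      rw [← hQt t a b]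
      simp only [mul_comm]
    have h4 : MemLp (fun ω => (∑ c, M c b * lagVector p (fun t => x t ω) (t - 1) c)
        + stackedNoise p eps t ω b) 2 P := (hlin t b).add (hu t b)
    rw [h1, integral_add_mul' (hlin t a) (hu t a) h4, integral_sum_mul _ _ (hz _) h4]
    simp only [h2, h3]
    rw [Matrix.add_apply, Matrix.mul_assoc, Matrix.mul_apply]
    congr 1
    refine Finset.sum_congr rfl fun c _ => ?_
    rw [Matrix.transpose_apply, Matrix.mul_apply]
    congr 1
    exact Finset.sum_congr rfl fun c' _ => mul_comm _ _
  have hΓb : ∀ t a b, |Γ t a b| ≤ 2 * C := fun t a b =>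
    (abs_integral_mul_le (hz t a) (hz t b)).trans (by rw [two_mul]; exact add_le_add (hC _ _) (hC _ _))
  -- The constant `Q` cancels in consecutive differences, which therefore solve the homogeneous
  -- recursion; being bounded, they vanish.
  have hstep : ∀ t, Γ t = Γ (t - 1) := by
    intro t
    have h0 := eq_zero_of_bounded_conj_recursion M hstable
      (fun k : ℕ => Γ (t - k) - Γ (t - k - 1)) (C := 2 * C + 2 * C)
      (fun k a b => by
        rw [Matrix.sub_apply]
        exact (abs_sub _ _).trans (add_le_add (hΓb _ _ _) (hΓb _ _ _)))
      (fun k => by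
        rw [Matrix.mul_sub, Matrix.sub_mul,
          show t - ((k + 1 : ℕ) : ℤ) = t - k - 1 by push_cast; ring,
          ← add_sub_add_right_eq_sub (Mᵀ * Γ (t - k - 1) * M) _ Q, ← hrec (t - k), ← hrec (t - k - 1)])
    simpa [sub_eq_zero] using h0
  have hconst : ∀ t, Γ t = Γ p := by
    intro t
    induction t using Int.inductionOn' (b := (p : ℤ)) with
    | zero => rfl
    | succ k _ ih => rw [hstep (k + 1), add_sub_cancel_right, ih]
    | pred k _ ih => rw [← hstep k, ih]
  have := congrFun (congrFun (hconst t) a) b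
  exact this

end Moments

/-! ### Deterministic bounds for the Lasso -/

theorem l1norm_nonneg {ι : Type*} [Fintype ι] (v : ι → ℝ) : 0 ≤ l1norm v :=
  Finset.sum_nonneg fun _ _ => abs_nonneg _

theorem l2norm_nonneg {ι : Type*} [Fintype ι] (v : ι → ℝ) : 0 ≤ l2norm v := Real.sqrt_nonneg _

theorem l2norm_sq {ι : Type*} [Fintype ι] (v : ι → ℝ) : l2norm v ^ 2 = ∑ i, v i ^ 2 :=
  Real.sq_sqrt (Finset.sum_nonneg fun _ _ => sq_nonneg _)

theorem l2norm_le_l1norm {ι : Type*} [Fintype ι] (v : ι → ℝ) : l2norm v ≤ l1norm v := by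
  refine Real.sqrt_le_iff.2 ⟨l1norm_nonneg v, ?_⟩
  have h := Finset.sum_sq_le_sq_sum_of_nonneg (s := Finset.univ) (f := fun i => |v i|)
    fun _ _ => abs_nonneg _
  simp only [sq_abs] at h
  exact h

theorem abs_le_l1norm {ι : Type*} [Fintype ι] (v : ι → ℝ) (i : ι) : |v i| ≤ l1norm v :=
  Finset.single_le_sum (f := fun i => |v i|) (fun _ _ => abs_nonneg _) (Finset.mem_univ i)

/-- The squared `ℓ¹` norm over a set of at most `K` coordinates is at most `K` times the squared
`ℓ²` norm. -/
theorem sum_abs_sq_le {ι : Type*} [Fintype ι] (B : Finset ι) {K : ℕ} (hB : B.card ≤ K)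
    (v : ι → ℝ) : (∑ i ∈ B, |v i|) ^ 2 ≤ K * ∑ i, v i ^ 2 := by
  have h1 : (∑ i ∈ B, |v i|) ^ 2 ≤ B.card * ∑ i ∈ B, |v i| ^ 2 := sq_sum_le_card_mul_sum_sq
  have h2 : ∑ i ∈ B, |v i| ^ 2 ≤ ∑ i, v i ^ 2 := by
    simp only [sq_abs]
    exact Finset.sum_le_sum_of_subset_of_nonneg (Finset.subset_univ _) fun _ _ _ => sq_nonneg _
  have hK : (B.card : ℝ) ≤ K := by exact_mod_cast hB
  refine h1.trans (mul_le_mul hK h2 (Finset.sum_nonneg fun _ _ => by positivity) (by positivity))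

/-- The `ℓ¹` oracle inequality for the Lasso under a restricted eigenvalue condition. -/
theorem lasso_l1norm_le {N : ℕ} {ι : Type*} [Fintype ι] [DecidableEq ι] (W : Matrix (Fin N) ι ℝ)
    (y η : Fin N → ℝ) (s₀ s : ι → ℝ) {T lam c M : ℝ} (hT : 0 < T) (hlam : 0 < lam) (hc : 0 < c)
    (hM : 0 ≤ M)
    (hy : y = W *ᵥ s₀ + η)
    (hs : 1 / (2 * T) * l2norm (y - W *ᵥ s) ^ 2 + lam * l1norm s
      ≤ 1 / (2 * T) * l2norm (y - W *ᵥ s₀) ^ 2 + lam * l1norm s₀)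
    (B : Finset ι) {K : ℕ} (hB : B.card ≤ K) (hs₀ : ∀ j, j ∉ B → s₀ j = 0)
    (hscore : ∀ a, |(Wᵀ *ᵥ η) a| ≤ T * (lam / 2))
    (hRE : ∀ v : ι → ℝ, T * c * ∑ i, v i ^ 2 - T * M * l1norm v ^ 2 ≤ ∑ k, (W *ᵥ v) k ^ 2)
    (hMc : 16 * K * M ≤ c / 2) :
    l1norm (fun j => s j - s₀ j) ≤ 24 * K * lam / c := by
  set v : ι → ℝ := fun j => s j - s₀ j with hv
  have hsv : s = s₀ + v := by funext j; simp [hv]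
  set Q := ∑ k, (W *ᵥ v) k ^ 2 with hQ
  have hQ0 : 0 ≤ Q := Finset.sum_nonneg fun _ _ => sq_nonneg _
  set b := ∑ j ∈ B, |v j| with hb
  set b' := ∑ j ∈ Bᶜ, |v j| with hb'
  have hb0 : 0 ≤ b := Finset.sum_nonneg fun _ _ => abs_nonneg _
  have hb'0 : 0 ≤ b' := Finset.sum_nonneg fun _ _ => abs_nonneg _
  have hl1 : l1norm v = b + b' := (Finset.sum_add_sum_compl B fun j => |v j|).symm
  have hcross : ∑ k, η k * (W *ᵥ v) k ≤ T * (lam / 2) * (b + b') := by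
    have e : ∑ k, η k * (W *ᵥ v) k = ∑ a, (Wᵀ *ᵥ η) a * v a := by
      change η ⬝ᵥ (W *ᵥ v) = (Wᵀ *ᵥ η) ⬝ᵥ v
      rw [Matrix.dotProduct_mulVec, Matrix.mulVec_transpose]
    rw [e, ← hl1, l1norm, Finset.mul_sum]
    refine Finset.sum_le_sum fun a _ => ?_
    refine (le_abs_self _).trans ?_
    rw [abs_mul]
    exact mul_le_mul_of_nonneg_right (hscore a) (abs_nonneg _)
  have hloss : l2norm (y - W *ᵥ s) ^ 2 = l2norm (y - W *ᵥ s₀) ^ 2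
      - 2 * ∑ k, η k * (W *ᵥ v) k + Q := by
    have e1 : y - W *ᵥ s₀ = η := by rw [hy]; abel
    have e2 : y - W *ᵥ s = η - W *ᵥ v := by rw [hy, hsv, Matrix.mulVec_add]; abel
    rw [e1, e2, l2norm_sq, l2norm_sq, hQ, Finset.mul_sum, ← Finset.sum_sub_distrib,
      ← Finset.sum_add_distrib]
    refine Finset.sum_congr rfl fun k _ => ?_
    rw [Pi.sub_apply]; ring
  have hpen : l1norm s₀ - l1norm s ≤ b - b' := by
    have e1 : l1norm s₀ - l1norm s = (∑ j ∈ B, (|s₀ j| - |s j|)) + ∑ j ∈ Bᶜ, (|s₀ j| - |s j|) := by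
      rw [Finset.sum_add_sum_compl, l1norm, l1norm, Finset.sum_sub_distrib]
    have e2 : ∑ j ∈ B, (|s₀ j| - |s j|) ≤ b := Finset.sum_le_sum fun j _ => by
      have := abs_sub_abs_le_abs_sub (s₀ j) (s j)
      rwa [abs_sub_comm] at this
    have e3 : ∑ j ∈ Bᶜ, (|s₀ j| - |s j|) = -b' := by
      rw [hb', ← Finset.sum_neg_distrib]
      refine Finset.sum_congr rfl fun j hj => ?_
      simp [hv, hs₀ j (Finset.mem_compl.1 hj)]
    rw [e1, e3]; linarith
  -- The penalties contribute `lam * (b - b')` and the score at most `lam / 2 * (b + b')`.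
  have hbasic : 1 / (2 * T) * Q ≤ 3 / 2 * lam * b - 1 / 2 * lam * b' := by
    rw [hloss] at hs
    have e1 : 1 / (2 * T) * (2 * ∑ k, η k * (W *ᵥ v) k) ≤ lam / 2 * (b + b') := by
      have := mul_le_mul_of_nonneg_left hcross (by positivity : 0 ≤ 1 / T)
      calc _ = 1 / T * ∑ k, η k * (W *ᵥ v) k := by field_simp
        _ ≤ 1 / T * (T * (lam / 2) * (b + b')) := this
        _ = _ := by field_simp
    have e2 := mul_le_mul_of_nonneg_left hpen hlam.le
    nlinarith
  have hcone : b' ≤ 3 * b := by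
    have h0 : 0 ≤ 1 / (2 * T) * Q := by positivity
    have : lam * b' ≤ lam * (3 * b) := by nlinarith
    exact le_of_mul_le_mul_left this hlam
  have hbK := sum_abs_sq_le B hB v
  rw [← hb] at hbK
  set V := ∑ i, v i ^ 2 with hV
  have hV0 : 0 ≤ V := Finset.sum_nonneg fun _ _ => sq_nonneg _
  have hquad : c / 2 * V ≤ 1 / T * Q := by
    have h1 := hRE v
    rw [hl1] at h1
    -- The cone condition gives `b + b' ≤ 4 b`, and `b ^ 2 ≤ K V`. So the perturbation `M` uses up
    -- at most half of `c`.
    have h2 : (b + b') ^ 2 ≤ 16 * (K * V) := by nlinarith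
    have h3 : M * (b + b') ^ 2 ≤ c / 2 * V := by
      calc M * (b + b') ^ 2 ≤ M * (16 * (K * V)) := mul_le_mul_of_nonneg_left h2 hM
        _ = 16 * K * M * V := by ring
        _ ≤ c / 2 * V := mul_le_mul_of_nonneg_right hMc hV0
    have h4 : T * (c / 2 * V) ≤ Q := by nlinarith
    calc c / 2 * V = 1 / T * (T * (c / 2 * V)) := by field_simp
      _ ≤ _ := mul_le_mul_of_nonneg_left h4 (by positivity)
  have hV2 : c * V ≤ 6 * lam * b := by
    have : 1 / (2 * T) * Q = 1 / 2 * (1 / T * Q) := by field_simp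
    nlinarith
  have hbfin : c * b ≤ 6 * K * lam := by
    have h1 : c * b ^ 2 ≤ 6 * K * lam * b := by
      calc c * b ^ 2 ≤ c * (K * V) := mul_le_mul_of_nonneg_left hbK hc.le
        _ = K * (c * V) := by ring
        _ ≤ K * (6 * lam * b) := mul_le_mul_of_nonneg_left hV2 (by positivity)
        _ = _ := by ring
    rcases hb0.eq_or_lt with h0 | h0
    · rw [← h0, mul_zero]; positivity
    · refine le_of_mul_le_mul_right ?_ h0
      nlinarith
  -- The factor `24` is `4 * 6`, from `b + b' ≤ 4 b` and `c b ≤ 6 K lam`.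
  rw [hl1, le_div_iff₀ hc]
  nlinarith

/-- A Lasso estimator is bounded in terms of the response. -/
theorem lasso_l1norm_le_response {N : ℕ} {ι : Type*} [Fintype ι] (W : Matrix (Fin N) ι ℝ)
    (y : Fin N → ℝ) (s : ι → ℝ) {T lam : ℝ} (hT : 0 < T) (hlam : 0 < lam)
    (hs : 1 / (2 * T) * l2norm (y - W *ᵥ s) ^ 2 + lam * l1norm s
      ≤ 1 / (2 * T) * l2norm (y - W *ᵥ (0 : ι → ℝ)) ^ 2 + lam * l1norm (0 : ι → ℝ)) :
    l1norm s ≤ (∑ k, y k ^ 2) / (2 * T * lam) := by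
  have h0 : l1norm (0 : ι → ℝ) = 0 := by simp [l1norm]
  rw [h0, mul_zero, add_zero, Matrix.mulVec_zero, sub_zero, l2norm_sq y] at hs
  have h1 : 0 ≤ 1 / (2 * T) * l2norm (y - W *ᵥ s) ^ 2 := by positivity
  rw [le_div_iff₀ (by positivity)]
  have h2 : lam * l1norm s ≤ 1 / (2 * T) * ∑ k, y k ^ 2 := by linarith
  calc l1norm s * (2 * T * lam) = 2 * T * (lam * l1norm s) := by ring
    _ ≤ 2 * T * (1 / (2 * T) * ∑ k, y k ^ 2) := mul_le_mul_of_nonneg_left h2 (by positivity)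
    _ = _ := by field_simp

/-! ### The population covariance matrix -/

theorem sum_sq_le_quadratic_form {n : Type*} [Fintype n] [DecidableEq n] {Sg : Matrix n n ℝ}
    (hsymm : Sgᵀ = Sg) {c : ℝ} (hspec : ∀ μ ∈ spectrum ℝ Sg, c < μ) (v : n → ℝ) :
    c * ∑ i, v i ^ 2 ≤ ∑ a, ∑ b, v a * v b * Sg a b := by
  have hpsd : (Sg - algebraMap ℝ (Matrix n n ℝ) c).PosSemidef := by
    rw [Matrix.posSemidef_iff_isHermitian_and_spectrum_nonneg]
    constructor
    · rw [Matrix.IsHermitian, Matrix.conjTranspose_eq_transpose_of_trivial, Matrix.transpose_sub,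
        hsymm, Matrix.algebraMap_eq_diagonal, Matrix.diagonal_transpose]
    · rw [← spectrum.sub_singleton_eq]
      rintro _ ⟨μ, hμ, _, rfl, rfl⟩
      exact sub_nonneg.2 (hspec μ hμ).le
  have h := hpsd.dotProduct_mulVec_nonneg v
  rw [star_trivial, Matrix.sub_mulVec, dotProduct_sub] at h
  have e1 : v ⬝ᵥ (algebraMap ℝ (Matrix n n ℝ) c) *ᵥ v = c * ∑ i, v i ^ 2 := by
    rw [Algebra.algebraMap_eq_smul_one, Matrix.smul_mulVec, Matrix.one_mulVec, dotProduct_smul,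
      smul_eq_mul, dotProduct]
    simp only [sq]
  have e2 : v ⬝ᵥ Sg *ᵥ v = ∑ a, ∑ b, v a * v b * Sg a b := by
    simp only [dotProduct, Matrix.mulVec, Finset.mul_sum]
    exact Finset.sum_congr rfl fun a _ => Finset.sum_congr rfl fun b _ => by ring
  rw [e1, e2] at h
  linarith

section Model

variable {Ω : Type*} [MeasurableSpace Ω] {P : Measure Ω}
variable {d p : ℕ} {A : Fin p → Matrix (Fin d) (Fin d) ℝ} {x eps : ℤ → Ω → Fin d → ℝ}

theorem sigmaZero_transpose (p : ℕ) (x : ℤ → Ω → Fin d → ℝ) :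
    (sigmaZero P p x)ᵀ = sigmaZero P p x := by
  ext a b
  simp only [Matrix.transpose_apply, sigmaZero, Matrix.of_apply, mul_comm]

/-- The normal equations of the regression of `x` on its past. -/
theorem integral_lagVector_mul_response
    (hAR : ∀ t : ℤ, ∀ᵐ ω ∂P, x t ω = (∑ j : Fin p, A j *ᵥ x (t - ((j : ℕ) + 1)) ω) + eps t ω)
    (hnoise : IsWhiteNoise P eps) (hx2 : ∀ t i, MemLp (fun ω => x t ω i) 2 P) {C : ℝ}
    (hC : ∀ t i, ∫ ω, x t ω i ^ 2 ∂P ≤ C)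
    (hstable : ∀ μ ∈ spectrum ℂ ((companion (paramMatrix A)).map (algebraMap ℝ ℂ)), ‖μ‖ < 1)
    (t : ℤ) (a : Fin p × Fin d) (l : Fin d) :
    ∫ ω, lagVector p (fun t => x t ω) (t - 1) a * x t ω l ∂P
      = ∑ b, paramMatrix A b l * sigmaZero P p x a b := by
  have h1 : ∫ ω, lagVector p (fun t => x t ω) (t - 1) a * x t ω l ∂P =
      ∫ ω, ((∑ b, paramMatrix A b l * lagVector p (fun t => x t ω) (t - 1) b) + eps t ω l)
        * lagVector p (fun t => x t ω) (t - 1) a ∂P := by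
    refine integral_congr_ae ?_
    filter_upwards [response_eq hAR] with ω hω
    rw [← hω t l, mul_comm]
  have hz := memLp_lagVector (p := p) hx2
  rw [h1, integral_add_mul' (memLp_finsetSum _ fun b _ => (hz _ b).const_mul _)
    (hnoise.memLp t l) (hz _ a), integral_sum_mul _ _ (hz _) (hz _ a)]
  simp only [mul_comm (eps t _ l), integral_lagVector_mul_noise hAR hnoise hx2 hC hstable
    (sub_one_lt t) a l, add_zero, integral_lagVector_mul_lagVector hAR hnoise hx2 hC hstable]
  refine Finset.sum_congr rfl fun b _ => ?_
  have := congrFun (congrFun (sigmaZero_transpose (P := P) p x) a) b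
  rw [Matrix.transpose_apply] at this
  rw [this]

/-- By the normal equations the quadratic form of `Σ⁰` at a column of `S` is the covariance of the
linear predictor with the response, which is at most the second moment of the response. -/
theorem sum_sq_paramMatrix_le
    (hAR : ∀ t : ℤ, ∀ᵐ ω ∂P, x t ω = (∑ j : Fin p, A j *ᵥ x (t - ((j : ℕ) + 1)) ω) + eps t ω)
    (hnoise : IsWhiteNoise P eps) (hx2 : ∀ t i, MemLp (fun ω => x t ω i) 2 P) {C : ℝ}
    (hC : ∀ t i, ∫ ω, x t ω i ^ 2 ∂P ≤ C)
    (hstable : ∀ μ ∈ spectrum ℂ ((companion (paramMatrix A)).map (algebraMap ℝ ℂ)), ‖μ‖ < 1)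
    {c : ℝ} (hc : 0 < c) (hspec : ∀ μ ∈ spectrum ℝ (sigmaZero P p x), c < μ) (l : Fin d) :
    ∑ a, paramMatrix A a l ^ 2 ≤ C / c := by
  rw [le_div_iff₀' hc]
  refine (sum_sq_le_quadratic_form (sigmaZero_transpose p x) hspec _).trans ?_
  have hz := memLp_lagVector (p := p) hx2
  set F : Ω → ℝ := fun ω => ∑ b, paramMatrix A b l * lagVector p (fun t => x t ω) (0 - 1) b with hF
  have hF2 : MemLp F 2 P := memLp_finsetSum _ fun b _ => (hz _ b).const_mul _
  have h1 : ∫ ω, F ω * x 0 ω l ∂P =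
      ∑ a, ∑ b, paramMatrix A a l * paramMatrix A b l * sigmaZero P p x a b := by
    rw [integral_sum_mul _ _ (hz _) (hx2 0 l)]
    simp only [integral_lagVector_mul_response hAR hnoise hx2 hC hstable, Finset.mul_sum, mul_assoc]
  have h2 : ∫ ω, F ω * eps 0 ω l ∂P = 0 := by
    rw [integral_sum_mul _ _ (hz _) (hnoise.memLp 0 l)]
    simp [integral_lagVector_mul_noise hAR hnoise hx2 hC hstable (show (-1 : ℤ) < 0 by norm_num)]
  rw [← h1]
  -- As `x = F + ε`, the two integrands differ by `ε²`.
  have h3 : ∫ ω, F ω * x 0 ω l ∂P ≤ ∫ ω, (x 0 ω l ^ 2 - F ω * eps 0 ω l) ∂P := by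
    refine integral_mono_ae (integrable_mul_of_memLp hF2 (hx2 0 l))
      ((hx2 0 l).integrable_sq.sub (integrable_mul_of_memLp hF2 (hnoise.memLp 0 l))) ?_
    filter_upwards [response_eq hAR] with ω hω
    have := hω 0 l
    simp only [hF]
    rw [this]
    set f := ∑ a, paramMatrix A a l * lagVector p (fun t => x t ω) (0 - 1) a
    nlinarith [sq_nonneg (eps 0 ω l)]
  rw [integral_sub (hx2 0 l).integrable_sq (integrable_mul_of_memLp hF2 (hnoise.memLp 0 l)), h2,
    sub_zero] at h3
  exact h3.trans (hC 0 l)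

end Model

/-! ### Sample covariances of the vector autoregression -/

section Sample

variable {Ω : Type*} [MeasurableSpace Ω] {P : Measure Ω}

/-- The centred sum of the products of two lagged coordinates. -/
def centredSum (P : Measure Ω) {d : ℕ} (x : ℤ → Ω → Fin d → ℝ) (c : ℤ) (N a b : ℕ) (i j : Fin d)
    (ω : Ω) : ℝ :=
  ∑ k ∈ Finset.range N, (x (c + k - a) ω i * x (c + k - b) ω j
    - ∫ ω', x (c + k - a) ω' i * x (c + k - b) ω' j ∂P)

variable {d p : ℕ} {A : Fin p → Matrix (Fin d) (Fin d) ℝ} {x eps : ℤ → Ω → Fin d → ℝ}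

/-- Centred sums are anchored at the first response time `p + 1`: regressors then have lags `1, …,
p` and the response has lag `0`. -/
theorem sum_design_mul_design
    (hAR : ∀ t : ℤ, ∀ᵐ ω ∂P, x t ω = (∑ j : Fin p, A j *ᵥ x (t - ((j : ℕ) + 1)) ω) + eps t ω)
    (hnoise : IsWhiteNoise P eps) (hx2 : ∀ t i, MemLp (fun ω => x t ω i) 2 P) {C : ℝ}
    (hC : ∀ t i, ∫ ω, x t ω i ^ 2 ∂P ≤ C)
    (hstable : ∀ μ ∈ spectrum ℂ ((companion (paramMatrix A)).map (algebraMap ℝ ℂ)), ‖μ‖ < 1)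
    (T : ℕ) (ω : Ω) (a b : Fin p × Fin d) :
    ∑ k, designMatrix p T (fun t => x t ω) k a * designMatrix p T (fun t => x t ω) k b
      = ((T - p : ℕ) : ℝ) * sigmaZero P p x a b
        + centredSum P x (p + 1) (T - p) (a.1 + 1) (b.1 + 1) a.2 b.2 ω := by
  have hidx : ∀ (k : ℕ) (j : Fin p), (p : ℤ) + 1 + k - ((j : ℕ) + 1 : ℕ) = p + k - (j : ℕ) := by
    intro k j; push_cast; ring
  have hint : ∀ k : ℕ, ∫ ω', x (p + k - (a.1 : ℕ)) ω' a.2 * x (p + k - (b.1 : ℕ)) ω' b.2 ∂P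
      = sigmaZero P p x a b := fun k =>
    integral_lagVector_mul_lagVector hAR hnoise hx2 hC hstable (p + k) a b
  simp only [centredSum, hidx, hint, Finset.sum_sub_distrib, Finset.sum_const, Finset.card_range,
    nsmul_eq_mul, Finset.sum_range, designMatrix, lagVector, Matrix.of_apply]
  ring

theorem sum_design_mul_response
    (hAR : ∀ t : ℤ, ∀ᵐ ω ∂P, x t ω = (∑ j : Fin p, A j *ᵥ x (t - ((j : ℕ) + 1)) ω) + eps t ω)
    (hnoise : IsWhiteNoise P eps) (hx2 : ∀ t i, MemLp (fun ω => x t ω i) 2 P) {C : ℝ}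
    (hC : ∀ t i, ∫ ω, x t ω i ^ 2 ∂P ≤ C)
    (hstable : ∀ μ ∈ spectrum ℂ ((companion (paramMatrix A)).map (algebraMap ℝ ℂ)), ‖μ‖ < 1)
    (T : ℕ) (ω : Ω) (a : Fin p × Fin d) (l : Fin d) :
    ∑ k, designMatrix p T (fun t => x t ω) k a * responseVector p T (fun t => x t ω) l k
      = ((T - p : ℕ) : ℝ) * (∑ b, paramMatrix A b l * sigmaZero P p x a b)
        + centredSum P x (p + 1) (T - p) (a.1 + 1) 0 a.2 l ω := by
  have hidx : ∀ (k : ℕ) (j : Fin p), (p : ℤ) + 1 + k - ((j : ℕ) + 1 : ℕ) = p + k - (j : ℕ) := by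
    intro k j; push_cast; ring
  have hidx' : ∀ k : ℕ, (p : ℤ) + 1 + k - (0 : ℕ) = p + 1 + k := by intro k; simp
  have hint : ∀ k : ℕ, ∫ ω', x (p + k - (a.1 : ℕ)) ω' a.2 * x (p + 1 + k) ω' l ∂P
      = ∑ b, paramMatrix A b l * sigmaZero P p x a b := fun k => by
    rw [← integral_lagVector_mul_response hAR hnoise hx2 hC hstable (p + 1 + k) a l]
    simp only [lagVector]
    rw [show (p : ℤ) + 1 + k - 1 = p + k by ring]
  simp only [centredSum, hidx, hidx', hint, Finset.sum_sub_distrib, Finset.sum_const,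
    Finset.card_range, nsmul_eq_mul, Finset.sum_range, designMatrix, lagVector, responseVector,
    Matrix.of_apply]
  ring

/-- The Lasso error is of order `lam` where all centred sums are small. -/
theorem lasso_error_le
    (hAR : ∀ t : ℤ, ∀ᵐ ω ∂P, x t ω = (∑ j : Fin p, A j *ᵥ x (t - ((j : ℕ) + 1)) ω) + eps t ω)
    (hnoise : IsWhiteNoise P eps) (hx2 : ∀ t i, MemLp (fun ω => x t ω i) 2 P) {C : ℝ}
    (hC : ∀ t i, ∫ ω, x t ω i ^ 2 ∂P ≤ C)
    (hstable : ∀ μ ∈ spectrum ℂ ((companion (paramMatrix A)).map (algebraMap ℝ ℂ)), ‖μ‖ < 1)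
    {c : ℝ} (hc : 0 < c) (hspec : ∀ μ ∈ spectrum ℝ (sigmaZero P p x), c < μ)
    {T K : ℕ} (hT : 1 ≤ T) (hTp : 2 * p ≤ T) {lam τ : ℝ} (hlam : 0 < lam) (hτ : 0 ≤ τ)
    (hτlam : τ * (1 + √(K * (C / c))) ≤ lam / 2) (hτc : 16 * K * τ ≤ c / 2 / 2)
    {l : Fin d} (hK : (trueSupport (paramMatrix A) l).card ≤ K) {ω : Ω}
    (hω : ∀ (t : ℤ) (l : Fin d), x t ω l =
      (∑ a, paramMatrix A a l * lagVector p (fun t => x t ω) (t - 1) a) + eps t ω l)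
    (hR : ∀ (a b : Fin (p + 1)) (i j : Fin d),
      |centredSum P x (p + 1) (T - p) a b i j ω| ≤ T * τ)
    {s : Fin p × Fin d → ℝ}
    (hs : IsMinOn (lassoObjective p T lam (fun t => x t ω) l) Set.univ s) :
    l1norm (fun j => s j - paramMatrix A j l) ≤ 24 * K * lam / (c / 2) := by
  have hT0 : (0 : ℝ) < T := by exact_mod_cast hT
  set W := designMatrix p T (fun t => x t ω) with hW
  set y := responseVector p T (fun t => x t ω) l with hy
  set η := responseVector p T (fun t => eps t ω) l with hη
  set S := paramMatrix A with hS
  have hyW : y = W *ᵥ (fun j => S j l) + η := by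
    funext k
    rw [hy, responseVector, hω, Pi.add_apply, Matrix.mulVec, dotProduct]
    congr 1
    refine Finset.sum_congr rfl fun a _ => ?_
    rw [mul_comm, hW, designMatrix, Matrix.of_apply,
      show (p : ℤ) + 1 + (k : ℕ) - 1 = p + (k : ℕ) by ring]
  set R : Fin p × Fin d → Fin p × Fin d → ℝ := fun a b =>
    centredSum P x (p + 1) (T - p) (a.1 + 1) (b.1 + 1) a.2 b.2 ω with hRdef
  have hRb : ∀ a b, |R a b| ≤ T * τ := fun a b => by
    simpa using hR a.1.succ b.1.succ a.2 b.2
  have hzz : ∀ a b, ∑ k, W k a * W k b = ((T - p : ℕ) : ℝ) * sigmaZero P p x a b + R a b :=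
    fun a b => sum_design_mul_design hAR hnoise hx2 hC hstable T ω a b
  have hSl1 : l1norm (fun j => S j l) ≤ √(K * (C / c)) := by
    refine Real.le_sqrt_of_sq_le ?_
    have e : l1norm (fun j => S j l) = ∑ j ∈ trueSupport S l, |S j l| := by
      symm
      refine Finset.sum_subset (Finset.subset_univ _) fun j _ hj => ?_
      simp only [trueSupport, Finset.mem_filter, Finset.mem_univ, true_and, not_not] at hj
      rw [hj, abs_zero]
    rw [e]
    refine (sum_abs_sq_le _ hK fun j => S j l).trans ?_
    exact mul_le_mul_of_nonneg_left
      (sum_sq_paramMatrix_le hAR hnoise hx2 hC hstable hc hspec l) (by positivity)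
  refine lasso_l1norm_le W y η (fun j => S j l) s (T := T) (lam := lam) (c := c / 2) (M := τ)
    hT0 hlam (by positivity) hτ hyW (hs (Set.mem_univ _)) (trueSupport S l) hK ?_ ?_ ?_ hτc
  · intro j hj
    simpa [trueSupport] using hj
  · intro a
    -- Substituting `η = y - W S`, the multiples of `T - p` cancel by the normal equations, and the
    -- score is expressed through centred sums of `x` alone.
    have e1 : (Wᵀ *ᵥ η) a = centredSum P x (p + 1) (T - p) (a.1 + 1) 0 a.2 l ω
        - ∑ b, S b l * R a b := by
      have e2 : ∀ k, η k = y k - ∑ b, W k b * S b l := fun k => by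
        rw [hyW, Pi.add_apply, Matrix.mulVec, dotProduct]; ring
      have e3 : (Wᵀ *ᵥ η) a = ∑ k, W k a * y k - ∑ b, S b l * ∑ k, W k a * W k b := by
        simp only [Matrix.mulVec, dotProduct, Matrix.transpose_apply, e2, mul_sub,
          Finset.sum_sub_distrib, Finset.mul_sum]
        rw [Finset.sum_comm (s := Finset.univ (α := Fin p × Fin d))]
        congr 1
        exact Finset.sum_congr rfl fun k _ => Finset.sum_congr rfl fun b _ => by ring
      have e4 : ∑ k, W k a * y k = ((T - p : ℕ) : ℝ) * (∑ b, S b l * sigmaZero P p x a b)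
          + centredSum P x (p + 1) (T - p) (a.1 + 1) 0 a.2 l ω :=
        sum_design_mul_response hAR hnoise hx2 hC hstable T ω a l
      rw [e3, e4]
      simp only [hzz, mul_add, Finset.sum_add_distrib, Finset.mul_sum]
      have e5 : ∀ b, S b l * (((T - p : ℕ) : ℝ) * sigmaZero P p x a b)
          = ((T - p : ℕ) : ℝ) * (S b l * sigmaZero P p x a b) := fun b => by ring
      simp only [e5]
      ring
    rw [e1]
    have e6 : |∑ b, S b l * R a b| ≤ l1norm (fun j => S j l) * (T * τ) := by
      rw [l1norm, Finset.sum_mul]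
      refine (Finset.abs_sum_le_sum_abs _ _).trans (Finset.sum_le_sum fun b _ => ?_)
      rw [abs_mul]
      exact mul_le_mul_of_nonneg_left (hRb a b) (abs_nonneg _)
    have e7 : |centredSum P x (p + 1) (T - p) (a.1 + 1) 0 a.2 l ω| ≤ T * τ := by
      simpa using hR a.1.succ 0 a.2 l
    have e8 := mul_le_mul_of_nonneg_right hSl1 (by positivity : 0 ≤ T * τ)
    have e9 := mul_le_mul_of_nonneg_left hτlam hT0.le
    refine (abs_sub _ _).trans ?_
    nlinarith
  · intro v
    have e1 : ∑ k, (W *ᵥ v) k ^ 2 = ∑ a, ∑ b, v a * v b * ∑ k, W k a * W k b := by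
      have e2 : ∀ k, (W *ᵥ v) k ^ 2 = ∑ a, ∑ b, v a * v b * (W k a * W k b) := fun k => by
        rw [sq, Matrix.mulVec, dotProduct, Finset.sum_mul_sum]
        exact Finset.sum_congr rfl fun a _ => Finset.sum_congr rfl fun b _ => by ring
      simp only [e2, Finset.mul_sum]
      rw [Finset.sum_comm]
      exact Finset.sum_congr rfl fun a _ => Finset.sum_comm
    have e3 : ∑ a, ∑ b, v a * v b * ∑ k, W k a * W k b =
        ((T - p : ℕ) : ℝ) * (∑ a, ∑ b, v a * v b * sigmaZero P p x a b)
          + ∑ a, ∑ b, v a * v b * R a b := by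
      simp only [hzz, mul_add, Finset.sum_add_distrib, Finset.mul_sum]
      congr 1
      exact Finset.sum_congr rfl fun a _ => Finset.sum_congr rfl fun b _ => by ring
    have e4 := sum_sq_le_quadratic_form (sigmaZero_transpose (P := P) p x) hspec v
    have e5 : |∑ a, ∑ b, v a * v b * R a b| ≤ T * τ * l1norm v ^ 2 := by
      rw [sq, l1norm, Finset.sum_mul_sum, Finset.mul_sum]
      refine (Finset.abs_sum_le_sum_abs _ _).trans (Finset.sum_le_sum fun a _ => ?_)
      rw [Finset.mul_sum]
      refine (Finset.abs_sum_le_sum_abs _ _).trans (Finset.sum_le_sum fun b _ => ?_)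
      rw [abs_mul, abs_mul, mul_comm]
      exact mul_le_mul_of_nonneg_right (hRb a b) (by positivity)
    -- At least half of the `T` time points remain as rows; this is why the eigenvalue bound enters
    -- as `c / 2`.
    have e6 : (T : ℝ) / 2 ≤ ((T - p : ℕ) : ℝ) := by
      have h1 : T ≤ 2 * (T - p) := by omega
      have h2 : (T : ℝ) ≤ 2 * ((T - p : ℕ) : ℝ) := by exact_mod_cast h1
      linarith
    have hV : 0 ≤ ∑ i, v i ^ 2 := Finset.sum_nonneg fun _ _ => sq_nonneg _
    have e7 : (T : ℝ) / 2 * (c * ∑ i, v i ^ 2) ≤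
        ((T - p : ℕ) : ℝ) * ∑ a, ∑ b, v a * v b * sigmaZero P p x a b :=
      mul_le_mul e6 e4 (by positivity) (by positivity)
    rw [e1, e3]
    have e8 := (abs_le.1 e5).1
    have e9 : (T : ℝ) * (c / 2) * ∑ i, v i ^ 2 = T / 2 * (c * ∑ i, v i ^ 2) := by ring
    linarith

/-- A union bound with Markov bounds for the centred sums. -/
theorem measure_centredSum_le {q B : ℝ} (hq : 0 < q) (hB : 0 ≤ B) {c : ℤ} {N n : ℕ}
    (hm : ∀ (a b : Fin n) (i j : Fin d),
      AEStronglyMeasurable (centredSum P x c N a b i j) P)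
    (hnorm : ∀ (a b : Fin n) (i j : Fin d),
      eLpNorm (centredSum P x c N a b i j) (ENNReal.ofReal q) P ≤ ENNReal.ofReal B)
    {r : ℝ} (hr : 0 < r) :
    P {ω | ¬ ∀ (a b : Fin n) (i j : Fin d), |centredSum P x c N a b i j ω| ≤ r} ≤
      ENNReal.ofReal ((n * d) ^ 2 * (B / r) ^ q) := by
  have hsub : {ω | ¬ ∀ (a b : Fin n) (i j : Fin d), |centredSum P x c N a b i j ω| ≤ r} ⊆
      ⋃ z : (Fin n × Fin d) × (Fin n × Fin d),
        {ω | ENNReal.ofReal r ≤ ‖centredSum P x c N z.1.1 z.2.1 z.1.2 z.2.2 ω‖ₑ} := by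
    intro ω hω
    simp only [Set.mem_ofPred_eq, not_forall, not_le] at hω
    obtain ⟨a, b, i, j, h⟩ := hω
    refine Set.mem_iUnion.2 ⟨((a, i), (b, j)), ?_⟩
    simp only [Set.mem_ofPred_eq]
    rw [← ofReal_norm, Real.norm_eq_abs]
    exact ENNReal.ofReal_le_ofReal h.le
  refine (measure_mono hsub).trans ((measure_iUnion_fintype_le P _).trans ?_)
  have hone : ∀ z : (Fin n × Fin d) × (Fin n × Fin d),
      P {ω | ENNReal.ofReal r ≤ ‖centredSum P x c N z.1.1 z.2.1 z.1.2 z.2.2 ω‖ₑ} ≤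
        ENNReal.ofReal ((B / r) ^ q) := by
    intro z
    refine (meas_ge_le_mul_pow_eLpNorm_enorm P (p := ENNReal.ofReal q) (by simpa using hq)
      (by simp) (hm _ _ _ _) (by simpa using hr) (by simp)).trans ?_
    rw [ENNReal.toReal_ofReal hq.le, ← ENNReal.mul_rpow_of_nonneg _ _ hq.le,
      ← ENNReal.ofReal_inv_of_pos hr]
    refine (ENNReal.rpow_le_rpow (mul_le_mul' le_rfl (hnorm _ _ _ _)) hq.le).trans ?_
    rw [← ENNReal.ofReal_mul (by positivity), ENNReal.ofReal_rpow_of_nonneg (by positivity) hq.le,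
      inv_mul_eq_div]
  refine (Finset.sum_le_sum fun z _ => hone z).trans (le_of_eq ?_)
  rw [Finset.sum_const, nsmul_eq_mul, ENNReal.ofReal_mul (by positivity), Finset.card_univ,
    Fintype.card_prod, Fintype.card_prod, Fintype.card_fin, Fintype.card_fin, ← sq]
  congr 1
  rw [← Nat.cast_mul, ← Nat.cast_pow, ENNReal.ofReal_natCast]

end Sample

/-! ### Stochastic order -/

/-- Tightness of one real variable: its upper tails decrease to the empty set. Allowing every larger
constant lets one constant serve finitely many variables. -/
theorem exists_measure_gt_le {Ω : Type*} [MeasurableSpace Ω] {P : Measure Ω}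
    [IsProbabilityMeasure P] {Y : Ω → ℝ} (hY : AEMeasurable Y P) {r ε : ℝ} (hr : 0 < r)
    (hε : 0 < ε) : ∃ C : ℝ, 0 < C ∧ ∀ C', C ≤ C' → P {ω | ¬ Y ω ≤ C' * r} ≤ ENNReal.ofReal ε := by
  have hlim : Tendsto (fun n : ℕ => P {ω | ¬ Y ω ≤ n * r}) atTop
      (𝓝 (P (⋂ n : ℕ, {ω | ¬ Y ω ≤ n * r}))) := by
    refine tendsto_measure_iInter_atTop (fun n => ?_) ?_ ⟨0, measure_ne_top _ _⟩
    · exact (nullMeasurableSet_le hY aemeasurable_const).compl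
    · intro n k hnk ω hω
      simp only [Set.mem_ofPred_eq, not_le] at hω ⊢
      refine lt_of_le_of_lt ?_ hω
      have : (n : ℝ) ≤ k := by exact_mod_cast hnk
      gcongr
  have hempty : (⋂ n : ℕ, {ω | ¬ Y ω ≤ n * r}) = ∅ := by
    refine Set.eq_empty_iff_forall_notMem.2 fun ω hω => ?_
    obtain ⟨n, hn⟩ := exists_nat_ge (Y ω / r)
    have := Set.mem_iInter.1 hω n
    exact this ((div_le_iff₀ hr).1 hn)
  rw [hempty, measure_empty] at hlim
  obtain ⟨n, hn, hn1⟩ := ((hlim.eventually (ge_mem_nhds (by simpa using hε :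
    (0 : ℝ≥0∞) < ENNReal.ofReal ε))).and (eventually_ge_atTop 1)).exists
  refine ⟨n, by exact_mod_cast hn1, fun C' hC' => (measure_mono fun ω hω => ?_).trans hn⟩
  simp only [Set.mem_ofPred_eq, not_le] at hω ⊢
  exact lt_of_le_of_lt (by gcongr) hω

/-- `IsBigOp` asks for all `n ≥ 1`, but the bad sets are small only eventually. The finitely many
remaining indices are handled by tightness of a measurable majorant, as `X n` itself need not be
measurable. -/
theorem isBigOp_of_eventually {Ω : Type*} [MeasurableSpace Ω] {P : Measure Ω}
    [IsProbabilityMeasure P] {X : ℕ → Ω → ℝ} {r : ℕ → ℝ} (hr : ∀ n, 1 ≤ n → 0 < r n)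
    {bad : ℕ → Set Ω} (hbad : Tendsto (fun n => P (bad n)) atTop (𝓝 0)) {C₀ : ℝ}
    (hX : ∀ᶠ n in atTop, ∀ ω ∉ bad n, |X n ω| ≤ C₀ * r n)
    (hY : ∀ n, 1 ≤ n → ∃ Y : Ω → ℝ, AEMeasurable Y P ∧ ∀ ω, |X n ω| ≤ Y ω) :
    IsBigOp P X fun n _ => r n := by
  intro ε hε _
  obtain ⟨n₀, hn₀⟩ := eventually_atTop.1 (hX.and (hbad.eventually (ge_mem_nhds (by simpa using hε :
    (0 : ℝ≥0∞) < ENNReal.ofReal ε))))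
  have hsmall : ∀ n, ∃ C : ℝ, 0 < C ∧ (1 ≤ n → ∀ C', C ≤ C' →
      P {ω | ¬ |X n ω| ≤ C' * r n} ≤ ENNReal.ofReal ε) := by
    intro n
    by_cases hn : 1 ≤ n
    · obtain ⟨Y, hYm, hYX⟩ := hY n hn
      obtain ⟨C, hC, hCε⟩ := exists_measure_gt_le hYm (hr n hn) hε
      refine ⟨C, hC, fun _ C' hC' => (measure_mono fun ω hω => ?_).trans (hCε C' hC')⟩
      simp only [Set.mem_ofPred_eq, not_le] at hω ⊢
      exact hω.trans_le (hYX ω)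
    · exact ⟨1, one_pos, fun h => absurd h hn⟩
  choose C hC hCε using hsmall
  have hsum : 0 ≤ ∑ n ∈ Finset.range n₀, C n := Finset.sum_nonneg fun n _ => (hC n).le
  refine ⟨|C₀| + 1 + ∑ n ∈ Finset.range n₀, C n, by positivity, fun n hn => ?_⟩
  simp only [abs_of_pos (hr n hn)]
  rcases lt_or_ge n n₀ with h | h
  · refine hCε n hn _ ?_
    have := Finset.single_le_sum (f := C) (fun k _ => (hC k).le) (Finset.mem_range.2 h)
    have := abs_nonneg C₀
    linarith
  · obtain ⟨h1, h2⟩ := hn₀ n h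
    refine (measure_mono fun ω hω => ?_).trans h2
    by_contra hb
    refine hω ((h1 ω hb).trans (mul_le_mul_of_nonneg_right ?_ (hr n hn).le))
    have := le_abs_self C₀
    linarith

/-! ### Auxiliary estimates for the main theorem -/

theorem memLp_two_of_eLpNorm_le {Ω : Type*} [MeasurableSpace Ω] {P : Measure Ω}
    [IsProbabilityMeasure P] {f : Ω → ℝ} (hf : AEStronglyMeasurable f P) {m C : ℝ} (hm : 2 ≤ m)
    (hC : 0 ≤ C) (hfC : eLpNorm f (ENNReal.ofReal m) P ≤ ENNReal.ofReal C) :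
    MemLp f 2 P ∧ ∫ ω, f ω ^ 2 ∂P ≤ C ^ 2 := by
  have h2m : (2 : ℝ≥0∞) ≤ ENNReal.ofReal m := by
    rw [← ENNReal.ofReal_ofNat]; exact ENNReal.ofReal_le_ofReal hm
  have h2 : eLpNorm f 2 P ≤ ENNReal.ofReal C :=
    (eLpNorm_le_eLpNorm_of_exponent_le h2m hf).trans hfC
  have hmem : MemLp f 2 P := ⟨hf, h2.trans_lt ENNReal.ofReal_lt_top⟩
  refine ⟨hmem, ?_⟩
  rw [hmem.eLpNorm_eq_integral_rpow_norm (by simp) (by simp), ENNReal.ofReal_le_ofReal_iff hC] at h2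
  simp only [ENNReal.toReal_ofNat, Real.rpow_ofNat, Real.norm_eq_abs, sq_abs] at h2
  have h0 : 0 ≤ ∫ ω, f ω ^ 2 ∂P := integral_nonneg fun _ => sq_nonneg _
  have h3 := pow_le_pow_left₀ (by positivity) h2 2
  rwa [← Real.rpow_natCast, ← Real.rpow_mul h0, Nat.cast_ofNat, inv_mul_cancel₀ two_ne_zero,
    Real.rpow_one] at h3

/-- The condition `0 ≤ M` covers an empty index type, whose real supremum is `0`. -/
theorem abs_iSup_le {ι : Type*} {f : ι → ℝ} {M : ℝ} (h0 : ∀ i, 0 ≤ f i) (hf : ∀ i, f i ≤ M)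
    (hM : 0 ≤ M) : |⨆ i, f i| ≤ M := by
  rw [abs_of_nonneg (Real.iSup_nonneg h0)]
  exact Real.iSup_le hf hM

/-- The expression is at most a constant times `T ^ (2 αd - (m / 2) (1 / 2 - αl))`. The exponent is
negative precisely when `αl < 1 / 2 - 4 αd / m`. -/
theorem tendsto_union_bound {p d : ℕ → ℕ} {lam : ℕ → ℝ} {Cp Cd αd αl cl m B κ : ℝ}
    (hp : ∀ T, 1 ≤ T → (p T : ℝ) ≤ Cp) (hd : ∀ T, 1 ≤ T → (d T : ℝ) ≤ Cd * (T : ℝ) ^ αd)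
    (hlam : ∀ T, 1 ≤ T → lam T = cl * (T : ℝ) ^ (-αl)) (hcl : 0 < cl) (hm : 0 < m)
    (hαl : αl < 1 / 2 - 4 * αd / m) (hB : 0 ≤ B) (hκ : 0 < κ) :
    Tendsto (fun T : ℕ => (((p T + 1 : ℕ) : ℝ) * d T) ^ 2
      * (B * √T / (T * (κ * lam T))) ^ (m / 2)) atTop (𝓝 0) := by
  set D := ((Cp + 1) * Cd) ^ 2 * (B / (κ * cl)) ^ (m / 2) with hD
  set γ := m / 2 * (1 / 2 - αl) - 2 * αd with hγ
  have hγ0 : 0 < γ := by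
    have h1 : 4 * αd / m < 1 / 2 - αl := by linarith
    rw [div_lt_iff₀ hm] at h1
    rw [hγ]; nlinarith
  have hlim : Tendsto (fun T : ℕ => D * (T : ℝ) ^ (-γ)) atTop (𝓝 0) := by
    have := ((tendsto_rpow_neg_atTop hγ0).comp tendsto_natCast_atTop_atTop).const_mul D
    simpa using this
  refine squeeze_zero' ?_ ?_ hlim
  · filter_upwards [eventually_ge_atTop 1] with T hT
    rw [hlam T hT]
    positivity
  · filter_upwards [eventually_ge_atTop 1] with T hT
    have hT0 : (0 : ℝ) < T := by exact_mod_cast hT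
    have h1 : ((p T + 1 : ℕ) : ℝ) * d T ≤ (Cp + 1) * (Cd * (T : ℝ) ^ αd) := by
      refine mul_le_mul ?_ (hd T hT) (by positivity) ?_
      · push_cast; linarith [hp T hT]
      · have := hp T hT
        have : (0 : ℝ) ≤ p T := by positivity
        linarith
    have h2 : (((p T + 1 : ℕ) : ℝ) * d T) ^ 2 ≤ ((Cp + 1) * Cd) ^ 2 * (T : ℝ) ^ (2 * αd) := by
      refine (pow_le_pow_left₀ (by positivity) h1 2).trans (le_of_eq ?_)
      rw [← mul_assoc, mul_pow, ← Real.rpow_natCast ((T : ℝ) ^ αd), ← Real.rpow_mul hT0.le]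
      congr 2
      push_cast; ring
    have h3 : B * √T / (T * (κ * lam T)) = B / (κ * cl) * (T : ℝ) ^ (αl - 1 / 2) := by
      rw [hlam T hT, Real.sqrt_eq_rpow]
      have e1 : (T : ℝ) ^ (αl - 1 / 2) = (T : ℝ) ^ (1 / 2 : ℝ) / (T * (T : ℝ) ^ (-αl)) := by
        nth_rewrite 3 [← Real.rpow_one (T : ℝ)]
        rw [← Real.rpow_add hT0, ← Real.rpow_sub hT0]
        congr 1; ring
      rw [e1]
      have := Real.rpow_pos_of_pos hT0 (-αl)
      field_simp
    have h4 : (B * √T / (T * (κ * lam T))) ^ (m / 2) =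
        (B / (κ * cl)) ^ (m / 2) * (T : ℝ) ^ ((αl - 1 / 2) * (m / 2)) := by
      rw [h3, Real.mul_rpow (by positivity) (by positivity), ← Real.rpow_mul hT0.le]
    rw [h4]
    refine (mul_le_mul_of_nonneg_right h2 (by positivity)).trans (le_of_eq ?_)
    have h5 : (T : ℝ) ^ (-γ) = (T : ℝ) ^ (2 * αd) * (T : ℝ) ^ ((αl - 1 / 2) * (m / 2)) := by
      rw [← Real.rpow_add hT0]; congr 1; rw [hγ]; ring
    rw [h5, hD]; ring

theorem thresholdSupport_eq {p d : ℕ} {S St : Matrix (Fin p × Fin d) (Fin d) ℝ} {b r : ℝ}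
    {l : Fin d} (hmin : ∀ j ∈ trueSupport S l, 2 * b < |S j l|) (hr : r < b)
    (herr : l1norm (fun j => St j l - S j l) ≤ r) : thresholdSupport St b l = trueSupport S l := by
  ext j
  have hj : |St j l - S j l| < b :=
    ((abs_le_l1norm (fun j => St j l - S j l) j).trans herr).trans_lt hr
  simp only [thresholdSupport, Finset.mem_filter, Finset.mem_univ, true_and]
  constructor
  · intro h
    by_contra hn
    have h0 : S j l = 0 := by simpa [trueSupport] using hn
    rw [h0, sub_zero] at hj
    linarith
  · intro h
    have h1 := hmin j h
    have h2 := abs_sub_abs_le_abs_sub (S j l) (St j l)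
    rw [abs_sub_comm] at h2
    linarith

/-- A measurable bound for the error of a Lasso estimator. -/
theorem exists_aemeasurable_lasso_bound {Ω : Type*} [MeasurableSpace Ω] {P : Measure Ω}
    {d p T : ℕ} (hT : 1 ≤ T) {lam : ℝ} (hlam : 0 < lam) {x : ℤ → Ω → Fin d → ℝ}
    (hx : ∀ t i, AEMeasurable (fun ω => x t ω i) P) (S : Matrix (Fin p × Fin d) (Fin d) ℝ)
    {St : Ω → Matrix (Fin p × Fin d) (Fin d) ℝ}
    (hSt : ∀ ω l, IsMinOn (lassoObjective p T lam (fun t => x t ω) l) Set.univ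
      (fun j => St ω j l)) :
    ∃ Y : Ω → ℝ, AEMeasurable Y P ∧ ∀ ω, 0 ≤ Y ω ∧
      ∀ l, l1norm (fun j => St ω j l - S j l) ≤ Y ω := by
  have hT0 : (0 : ℝ) < T := by exact_mod_cast hT
  set Z : Fin d → Ω → ℝ := fun l ω =>
    (∑ k, responseVector p T (fun t => x t ω) l k ^ 2) / (2 * T * lam) + l1norm fun j => S j l
    with hZ
  have hZ0 : ∀ l ω, 0 ≤ Z l ω := fun l ω =>
    add_nonneg (div_nonneg (Finset.sum_nonneg fun _ _ => sq_nonneg _) (by positivity))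
      (l1norm_nonneg _)
  refine ⟨fun ω => ∑ l, Z l ω, ?_, fun ω => ⟨Finset.sum_nonneg fun l _ => hZ0 l ω, fun l => ?_⟩⟩
  · refine Finset.aemeasurable_fun_sum _ fun l _ => AEMeasurable.add_const ?_ _
    exact (Finset.aemeasurable_fun_sum _ fun k _ => (hx _ l).pow_const 2).div_const _
  · refine le_trans ?_ (Finset.single_le_sum (f := fun l => Z l ω) (fun l _ => hZ0 l ω)
      (Finset.mem_univ l))
    -- Comparison with the zero vector bounds the minimizer by the response, so the majorant is
    -- measurable whatever choice of minimizer is made.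
    have h1 := lasso_l1norm_le_response _ _ _ hT0 hlam (hSt ω l (Set.mem_univ 0))
    refine le_trans ?_ (add_le_add h1 le_rfl)
    rw [l1norm, l1norm, l1norm, ← Finset.sum_add_distrib]
    exact Finset.sum_le_sum fun j _ => abs_sub _ _

end

end LassoVAR

/-! ### The main theorem -/

theorem mainTheorem4
    {Ω E : Type*} [MeasurableSpace Ω] [MeasurableSpace E]
    (P : Measure Ω) [IsProbabilityMeasure P]
    -- the independent variables that drive the process
    (e : ℤ → Ω → E) (he_meas : ∀ t, Measurable (e t)) (he_indep : iIndepFun e P)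
    -- for every sample size `T`: dimension, order, coefficients, process and innovations
    (d p : ℕ → ℕ)
    (A : (T : ℕ) → Fin (p T) → Matrix (Fin (d T)) (Fin (d T)) ℝ)
    (x eps : (T : ℕ) → ℤ → Ω → Fin (d T) → ℝ)
    (m α αd αl cl cS cL : ℝ) (lam b : ℕ → ℝ)
    -- the autoregressive model, short range dependence, growth of order and dimension
    (hAR : ∀ T, 1 ≤ T → ∀ t : ℤ, ∀ᵐ ω ∂P,
      x T t ω = (∑ j : Fin (p T), A T j *ᵥ x T (t - ((j : ℕ) + 1)) ω) + eps T t ω)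
    (hnoise : ∀ T, 1 ≤ T → LassoVAR.IsWhiteNoise P (eps T))
    (hm : 8 < m) (hα : 1 < α)
    (hsrd : LassoVAR.IsShortRangeDependent P e m α d x)
    (hp : ∃ C : ℝ, ∀ T, 1 ≤ T → (p T : ℝ) ≤ C)
    (hd : ∃ C : ℝ, ∀ T, 1 ≤ T → (d T : ℝ) ≤ C * (T : ℝ) ^ αd)
    (hαd : 0 ≤ αd) (hαd' : αd < m * α / (2 + 24 * α))
    -- tuning parameters, sparsity, stability, non-degenerate covariance
    (hlam : ∀ T, 1 ≤ T → lam T = cl * (T : ℝ) ^ (-αl))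
    (hcl : 0 < cl) (hαl : 0 < αl) (hαl' : αl < 1 / 2 - 4 * αd / m)
    (hb : Tendsto b atTop (𝓝 0))
    (hblam : Tendsto (fun T => b T / lam T) atTop atTop)
    (hsparse : ∃ K : ℕ, ∀ T, 1 ≤ T → (Finset.univ.sup fun l =>
      (LassoVAR.trueSupport (LassoVAR.paramMatrix (A T)) l).card) ≤ K)
    (hnonzero : ∀ T, 1 ≤ T → 0 < (Finset.univ.sup fun l =>
      (LassoVAR.trueSupport (LassoVAR.paramMatrix (A T)) l).card))
    (hmin : ∀ T, 1 ≤ T → ∀ l, ∀ j ∈ LassoVAR.trueSupport (LassoVAR.paramMatrix (A T)) l,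
      2 * b T < |LassoVAR.paramMatrix (A T) j l|)
    (hstable : ∀ T, 1 ≤ T → ∀ μ ∈ spectrum ℂ
      ((LassoVAR.companion (LassoVAR.paramMatrix (A T))).map (algebraMap ℝ ℂ)), ‖μ‖ < 1)
    (hcS : 0 < cS)
    (hSigma : ∀ T, 1 ≤ T → ∀ μ ∈ spectrum ℝ (LassoVAR.sigmaZero P (p T) (x T)), cS < μ)
    -- non-degenerate asymptotic variances
    (hcL : 0 < cL)
    (hLambda : ∀ᶠ T in atTop, ∀ l, ∀ j ∈ LassoVAR.trueSupport (LassoVAR.paramMatrix (A T)) l,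
      cL < LassoVAR.lambdaMatrix P T (A T) (x T) (eps T) l l j j)
    -- the Lasso estimator; where the minimizer is not unique, any choice of it
    (St : (T : ℕ) → Ω → Matrix (Fin (p T) × Fin (d T)) (Fin (d T)) ℝ)
    (hSt : ∀ T, 1 ≤ T → ∀ ω l, IsMinOn
      (LassoVAR.lassoObjective (p T) T (lam T) (fun t => x T t ω) l) Set.univ
      (fun j => St T ω j l)) :
    LassoVAR.IsBigOp P
      (fun T ω => ⨆ l, LassoVAR.l1norm fun j => St T ω j l - LassoVAR.paramMatrix (A T) j l)
      (fun T _ => lam T) ∧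
    LassoVAR.IsBigOp P
      (fun T ω => ⨆ l, LassoVAR.l2norm fun j => St T ω j l - LassoVAR.paramMatrix (A T) j l)
      (fun T _ => lam T) ∧
    Tendsto (fun T => P {ω | ∃ l, LassoVAR.thresholdSupport (St T ω) (b T) l ≠
      LassoVAR.trueSupport (LassoVAR.paramMatrix (A T)) l}) atTop (𝓝 0) := by
  obtain ⟨g, hgm, hgx, -, ⟨C₀, hC₀⟩, ⟨C₂, hC₂⟩⟩ := hsrd
  obtain ⟨Cp, hCp⟩ := hp
  obtain ⟨Cd, hCd⟩ := hd
  obtain ⟨K, hK⟩ := hsparse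
  have hx_meas : ∀ T, 1 ≤ T → ∀ t i, AEMeasurable (fun ω => x T t ω i) P := fun T hT t i =>
    ⟨fun ω => g T t i fun k => e (t - k) ω,
      (hgm T t i).comp (measurable_pi_lambda _ fun k => he_meas _), hgx T hT t i⟩
  have hxm : ∀ T, 1 ≤ T → ∀ t i,
      eLpNorm (fun ω => x T t ω i) (ENNReal.ofReal m) P ≤ ENNReal.ofReal |C₀| :=
    fun T hT t i => (hC₀ T hT t i).trans (ENNReal.ofReal_le_ofReal (le_abs_self _))
  have hδ : ∀ T, 1 ≤ T →
      ∑' j, LassoVAR.dependenceCoeff P e m (g T) j ≤ ENNReal.ofReal |C₂| := fun T hT => by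
    -- At `k = 0` the weight is `1`, leaving the sum of all dependence coefficients.
    have h := hC₂ T hT 0
    simp only [Nat.cast_zero, add_zero, Real.one_rpow, ENNReal.ofReal_one, one_mul,
      zero_add] at h
    exact h.trans (ENNReal.ofReal_le_ofReal (le_abs_self _))
  have hmom : ∀ T, 1 ≤ T → ∀ t i, MemLp (fun ω => x T t ω i) 2 P ∧
      ∫ ω, x T t ω i ^ 2 ∂P ≤ |C₀| ^ 2 := fun T hT t i =>
    LassoVAR.memLp_two_of_eLpNorm_le (hx_meas T hT t i).aestronglyMeasurable (by linarith)
      (abs_nonneg _) (hxm T hT t i)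
  have hlam0 : ∀ T, 1 ≤ T → 0 < lam T := fun T hT => by
    have : (0 : ℝ) < T := by exact_mod_cast hT
    rw [hlam T hT]; positivity
  have hlam_lim : Tendsto lam atTop (𝓝 0) := by
    have h := ((tendsto_rpow_neg_atTop hαl).comp tendsto_natCast_atTop_atTop).const_mul cl
    rw [mul_zero] at h
    refine h.congr' ?_
    filter_upwards [eventually_ge_atTop 1] with T hT
    rw [hlam T hT]; rfl
  -- the level below which all centred sums are small
  set κ : ℝ := 1 / (2 * (1 + √(K * (|C₀| ^ 2 / cS)))) with hκ
  have hκ0 : 0 < κ := by positivity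
  have hκlam : ∀ T, κ * lam T * (1 + √(K * (|C₀| ^ 2 / cS))) = lam T / 2 := fun T => by
    rw [hκ]; field_simp
  -- The factor of `√T` in the `L^{m/2}` bound for a centred sum.
  set B : ℝ := LassoVAR.momentConst (m / 2) * (2 * (|C₀| * |C₂|)) with hB
  have hmc := (LassoVAR.momentConst_pos (q := m / 2) (by linarith)).le
  have hB0 : 0 ≤ B := by positivity
  set bad₁ : ℕ → Set Ω := fun T => {ω | ¬ ∀ (a b : Fin (p T + 1)) (i j : Fin (d T)),
    |LassoVAR.centredSum P (x T) (p T + 1) (T - p T) a b i j ω| ≤ T * (κ * lam T)} with hbad₁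
  -- A null set, removed because the Lasso bound is pathwise and needs the regression equation at
  -- every time.
  set bad₂ : ℕ → Set Ω := fun T => {ω | ¬ ∀ (t : ℤ) (l : Fin (d T)), x T t ω l =
    (∑ a, LassoVAR.paramMatrix (A T) a l
      * LassoVAR.lagVector (p T) (fun t => x T t ω) (t - 1) a) + eps T t ω l} with hbad₂
  have hP₁ : ∀ T, 1 ≤ T → P (bad₁ T) ≤ ENNReal.ofReal ((((p T + 1 : ℕ) : ℝ) * d T) ^ 2
      * (B * √T / (T * (κ * lam T))) ^ (m / 2)) := fun T hT => by
    have hT0 : (0 : ℝ) < T := by exact_mod_cast hT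
    refine LassoVAR.measure_centredSum_le (by linarith) (by positivity) ?_ ?_
      (mul_pos hT0 (mul_pos hκ0 (hlam0 T hT)))
    · intro a b i j
      refine (Finset.aemeasurable_fun_sum _ fun k _ => ?_).aestronglyMeasurable
      exact ((hx_meas T hT _ i).mul (hx_meas T hT _ j)).sub_const _
    · intro a b i j
      refine (LassoVAR.eLpNorm_sum_mul_sub_integral_le he_meas he_indep (by linarith) (hgm T)
        (hgx T hT) (hxm T hT) (hδ T hT) _ a b i j _).trans ?_
      rw [← ENNReal.ofReal_mul (abs_nonneg _), ← ENNReal.ofReal_ofNat,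
        ← ENNReal.ofReal_mul (by norm_num), ← ENNReal.ofReal_mul (by positivity)]
      refine ENNReal.ofReal_le_ofReal ?_
      have h1 : √((T - p T : ℕ) : ℝ) ≤ √T :=
        Real.sqrt_le_sqrt (by exact_mod_cast Nat.sub_le T (p T))
      rw [hB]
      calc _ = LassoVAR.momentConst (m / 2) * (2 * (|C₀| * |C₂|)) * √((T - p T : ℕ) : ℝ) := by ring
        _ ≤ _ := by gcongr
  have hP₂ : ∀ T, 1 ≤ T → P (bad₂ T) = 0 := fun T hT => LassoVAR.response_eq (hAR T hT)
  have hbad : Tendsto (fun T => P (bad₁ T ∪ bad₂ T)) atTop (𝓝 0) := by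
    have h := ENNReal.tendsto_ofReal (LassoVAR.tendsto_union_bound hCp hCd hlam hcl
      (by linarith : 0 < m) hαl' hB0 hκ0)
    rw [ENNReal.ofReal_zero] at h
    refine tendsto_of_tendsto_of_tendsto_of_le_of_le' tendsto_const_nhds h
      (Eventually.of_forall fun _ => zero_le) ?_
    filter_upwards [eventually_ge_atTop 1] with T hT
    refine (measure_union_le _ _).trans ?_
    rw [hP₂ T hT, add_zero]
    exact hP₁ T hT
  set C : ℝ := 24 * K / (cS / 2) with hC
  have hC0 : 0 ≤ C := by positivity
  have hgood : ∀ᶠ T in atTop, ∀ ω ∉ bad₁ T ∪ bad₂ T, ∀ l,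
      LassoVAR.l1norm (fun j => St T ω j l - LassoVAR.paramMatrix (A T) j l) ≤ C * lam T := by
    have h1 : ∀ᶠ T in atTop, 16 * K * (κ * lam T) ≤ cS / 2 / 2 := by
      have h := (hlam_lim.const_mul κ).const_mul (16 * (K : ℝ))
      rw [mul_zero, mul_zero] at h
      exact h.eventually (ge_mem_nhds (by positivity))
    have h2 : ∀ᶠ T : ℕ in atTop, 2 * Cp ≤ T :=
      tendsto_natCast_atTop_atTop.eventually_ge_atTop _
    filter_upwards [h1, h2, eventually_ge_atTop 1] with T hT1 hT2 hT ω hω l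
    rw [Set.mem_union, not_or] at hω
    have hTp : 2 * p T ≤ T := by
      have : (2 : ℝ) * p T ≤ T := by linarith [hCp T hT]
      exact_mod_cast this
    have hKl : (LassoVAR.trueSupport (LassoVAR.paramMatrix (A T)) l).card ≤ K :=
      (Finset.le_sup (f := fun l =>
        (LassoVAR.trueSupport (LassoVAR.paramMatrix (A T)) l).card) (Finset.mem_univ l)).trans
        (hK T hT)
    refine (LassoVAR.lasso_error_le (hAR T hT) (hnoise T hT) (fun t i => (hmom T hT t i).1)
      (fun t i => (hmom T hT t i).2) (hstable T hT) hcS (hSigma T hT) hT hTp (hlam0 T hT)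
      (mul_pos hκ0 (hlam0 T hT)).le (hκlam T).le hT1 hKl (not_not.1 hω.2) (not_not.1 hω.1)
      (hSt T hT ω l)).trans (le_of_eq ?_)
    rw [hC]; ring
  have hbound : ∀ T, 1 ≤ T → ∃ Y : Ω → ℝ, AEMeasurable Y P ∧ ∀ ω, 0 ≤ Y ω ∧
      ∀ l, LassoVAR.l1norm (fun j => St T ω j l - LassoVAR.paramMatrix (A T) j l) ≤ Y ω :=
    fun T hT => LassoVAR.exists_aemeasurable_lasso_bound hT (hlam0 T hT) (hx_meas T hT) _
      (hSt T hT)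
  refine ⟨?_, ?_, ?_⟩
  · refine LassoVAR.isBigOp_of_eventually hlam0 hbad (C₀ := C) ?_ fun T hT => ?_
    · filter_upwards [hgood, eventually_ge_atTop 1] with T h hT ω hω
      exact LassoVAR.abs_iSup_le (fun l => LassoVAR.l1norm_nonneg _) (h ω hω)
        (mul_nonneg hC0 (hlam0 T hT).le)
    · obtain ⟨Y, hY, hYb⟩ := hbound T hT
      exact ⟨Y, hY, fun ω => LassoVAR.abs_iSup_le (fun l => LassoVAR.l1norm_nonneg _)
        (hYb ω).2 (hYb ω).1⟩
  · refine LassoVAR.isBigOp_of_eventually hlam0 hbad (C₀ := C) ?_ fun T hT => ?_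
    · filter_upwards [hgood, eventually_ge_atTop 1] with T h hT ω hω
      exact LassoVAR.abs_iSup_le (fun l => LassoVAR.l2norm_nonneg _)
        (fun l => (LassoVAR.l2norm_le_l1norm _).trans (h ω hω l))
        (mul_nonneg hC0 (hlam0 T hT).le)
    · obtain ⟨Y, hY, hYb⟩ := hbound T hT
      exact ⟨Y, hY, fun ω => LassoVAR.abs_iSup_le (fun l => LassoVAR.l2norm_nonneg _)
        (fun l => (LassoVAR.l2norm_le_l1norm _).trans ((hYb ω).2 l)) (hYb ω).1⟩
  · refine tendsto_of_tendsto_of_tendsto_of_le_of_le' tendsto_const_nhds hbad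
      (Eventually.of_forall fun _ => zero_le) ?_
    -- Once `C λ < b_T`, an error of at most `C λ` keeps zero entries below the threshold and the
    -- others, larger than `2 b_T`, above it.
    filter_upwards [hgood, hblam.eventually_gt_atTop C, eventually_ge_atTop 1] with T h hbT hT
    refine measure_mono fun ω hω => ?_
    by_contra hn
    obtain ⟨l, hl⟩ := hω
    exact hl (LassoVAR.thresholdSupport_eq (hmin T hT l)
      ((lt_div_iff₀ (hlam0 T hT)).1 hbT) (h ω hn l))
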